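/- Let $n\ge 1$ and let $E$ be an $SU(n)$-vector bundle over a finite-dimensional paracompact Hausdorff smooth manifold $M$ (without boundary): a smooth complex hermitian vector bundle of rank $n$ together with a smooth trivialization of $\bigwedge^n E$. Let $\mathfrak A=\Gamma(\mathrm{End}(E))$ be the unital algebra of smooth sections of $\mathrm{End}(E)$, $\mathcal Z(\mathfrak A)$ its centre, and $\mathrm{Der}(\mathfrak A)$ the Lie algebra and $\mathcal Z(\mathfrak A)$-module of its $\mathbb C$-linear derivations. Noncommutative $p$-forms ($p=1,2$) are the $\mathcal Z(\mathfrak A)$-multilinear antisymmetric maps $\mathrm{Der}(\mathfrak A)^p\to\mathfrak A$; for a $1$-form $\alpha$, $$\hat d\alpha(\mathcal X,\mathcal Y)=\mathcal X\,\alpha(\mathcal Y)-\mathcal Y\,\alpha(\mathcal X)-\alpha([\mathcal X,\mathcal Y]),\qquad \alpha^2(\mathcal X,\mathcal Y)=[\alpha(\mathcal X),\alpha(\mathcal Y)].$$ A $2$-form $\omega$ is horizontal if $\omega(ad_\gamma,\mathcal Y)=0$ for all $\gamma\in\mathfrak A$ and $\mathcal Y\in\mathrm{Der}(\mathfrak A)$,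 where $ad_\gamma S=[\gamma,S]$. Let $\nabla^E$ be a smooth ($\mathbb C$-linear) connection on $E$ compatible with the trivialization of $\bigwedge^nE$ (for instance an $SU(n)$-connection, i.e. one that is moreover hermitian), extended $\mathbb C$-linearly to complex vector fields $X\in\Gamma(TM\otimes\mathbb C)$, and let $\nabla_XS=[\nabla^E_X,S]$ be the induced connection on $\mathrm{End}(E)$. Then: 1. Every $\mathcal X\in\mathrm{Der}(\mathfrak A)$ has a unique image $X$, i.e. there is a unique smooth complex vector field $X$ such that $\mathcal X(f\mathbf 1)=(Xf)\mathbf 1$ for all $f\in C^\infty(M,\mathbb C)$. 2. There is a unique noncommutative $1$-form $\alpha$ with traceless values such that $\mathcal X=\nabla_X-ad_{\alpha(\mathcal X)}$ on $\mathfrak A$ for every $\mathcal X\in\mathrm{Der}(\mathfrak A)$ with image $X$. It is called the $1$-form associated to $\nabla^E$. 3. Let $R^E(X,Y)=[\nabla^E_X,\nabla^E_Y]-\nabla^E_{[X,Y]}$ be the curvature of $\nabla^E$. Then for all $\mathcal X,\mathcal Y\in\mathrm{Der}(\mathfrak A)$ with images $X,Y$, $$R^E(X,Y)=\hat d\alpha(\mathcal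 X,\mathcal Y)+[\alpha(\mathcal X),\alpha(\mathcal Y)].$$ 4. The noncommutative $2$-form $\hat d\alpha+\alpha^2$ is horizontal. -/

import Mathlib

open Bundle VectorField
open scoped Manifold ContDiff

set_option linter.unusedSectionVars false

noncomputable section

/-! ### The differential calculus based on derivations of an associative algebra -/

namespace DerCalc

section Algebra

attribute [local instance] LieRing.ofAssociativeRing

variable (R A : Type*) [CommRing R] [Ring A] [Algebra R A]

/-- The centre `Z(A)`. -/
abbrev Z : Subalgebra R A := Subalgebra.center R A

/-- The Lie algebra of `R`-linear derivations of a (noncommutative) associative algebra,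
with the commutator as bracket. -/
def Der : LieSubalgebra R (Module.End R A) where
  carrier := {D | ∀ a b : A, D (a * b) = D a * b + a * D b}
  add_mem' := by
    intro D D' h h' a b
    simp only [LinearMap.add_apply, h a b, h' a b]
    noncomm_ring
  zero_mem' := by
    intro a b
    simp
  smul_mem' := by
    intro c D h a b
    simp only [LinearMap.smul_apply, h a b, smul_add, smul_mul_assoc, mul_smul_comm]
  lie_mem' := by
    intro D D' h h' a b
    have h1 : ∀ a b : A, D (a * b) = D a * b + a * D b := h
    have h2 : ∀ a b : A, D' (a * b) = D' a * b + a * D' b := h'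
    simp only [LieRing.of_associative_ring_bracket, LinearMap.sub_apply, Module.End.mul_apply,
      h1, h2, map_add]
    noncomm_ring

variable {R A}

theorem Der.leibniz (D : Der R A) (a b : A) : D.1 (a * b) = D.1 a * b + a * D.1 b :=
  D.2 a b

theorem Der.lie_apply (D D' : Der R A) (a : A) :
    (⁅D, D'⁆ : Der R A).1 a = D.1 (D'.1 a) - D'.1 (D.1 a) := rfl

theorem Der.map_center (D : Der R A) (z : Z R A) (a : A) : a * D.1 z = D.1 z * a := by
  have hz : ∀ b : A, b * (z : A) = z * b := fun b => Subalgebra.mem_center_iff.1 z.2 b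
  have h := congrArg D.1 (hz a)
  rw [Der.leibniz D, Der.leibniz D, hz (D.1 a)] at h
  have h' : (z : A) * D.1 a + a * D.1 z = (z : A) * D.1 a + D.1 z * a := by
    rw [h]; abel
  exact add_left_cancel h'

/-- A derivation maps the centre to itself. -/
def Der.onCenter (D : Der R A) (z : Z R A) : Z R A :=
  ⟨D.1 z, Subalgebra.mem_center_iff.2 fun a => Der.map_center D z a⟩

instance : SMul (Z R A) (Der R A) where
  smul z D := ⟨LinearMap.mulLeft R (z : A) ∘ₗ D.1, by
    intro a b
    have hz : a * (z : A) = z * a := Subalgebra.mem_center_iff.1 z.2 a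
    simp only [LinearMap.comp_apply, LinearMap.mulLeft_apply, Der.leibniz D, mul_add, mul_assoc]
    rw [← mul_assoc a, hz, mul_assoc]⟩

theorem Der.smul_apply (z : Z R A) (D : Der R A) (a : A) : (z • D).1 a = (z : A) * D.1 a := rfl

theorem Der.ext' {D D' : Der R A} (h : ∀ a, D.1 a = D'.1 a) : D = D' :=
  Subtype.ext (LinearMap.ext h)

/-- The derivations form a module over the centre: `(z • D) a = z * D a`. -/
instance : Module (Z R A) (Der R A) where
  one_smul _ := Der.ext' fun _ => one_mul _
  mul_smul _ _ _ := Der.ext' fun _ => mul_assoc _ _ _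
  smul_zero _ := Der.ext' fun _ => mul_zero _
  smul_add _ _ _ := Der.ext' fun _ => mul_add _ _ _
  add_smul _ _ _ := Der.ext' fun _ => add_mul _ _ _
  zero_smul _ := Der.ext' fun _ => zero_mul _

theorem Der.lie_smul (D D' : Der R A) (z : Z R A) :
    ⁅D, z • D'⁆ = z • ⁅D, D'⁆ + Der.onCenter D z • D' := by
  refine Der.ext' fun a => ?_
  change D.1 ((z : A) * D'.1 a) - (z : A) * D'.1 (D.1 a)
    = (z : A) * (D.1 (D'.1 a) - D'.1 (D.1 a)) + D.1 z * D'.1 a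
  rw [Der.leibniz D]
  noncomm_ring

/-- The inner derivation `a ↦ [γ, a]`. -/
def inner (γ : A) : Der R A :=
  ⟨LinearMap.mulLeft R γ - LinearMap.mulRight R γ, by
    intro a b
    simp only [LinearMap.sub_apply, LinearMap.mulLeft_apply, LinearMap.mulRight_apply]
    noncomm_ring⟩

theorem inner_apply (γ a : A) : (inner γ : Der R A).1 a = γ * a - a * γ := rfl

variable (R A)

/-- The noncommutative `1`-forms: `Z(A)`-linear maps from the derivations to `A`. -/
abbrev Form₁ : Type _ := Der R A →ₗ[Z R A] A

/-- The noncommutative `2`-forms: `Z(A)`-bilinear antisymmetric (alternating) maps from the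
derivations to `A`. -/
def Form₂ : Submodule (Z R A) (Der R A →ₗ[Z R A] Der R A →ₗ[Z R A] A) where
  carrier := {B | ∀ D, B D D = 0}
  add_mem' := by
    intro B B' h h' D
    simp [h D, h' D]
  zero_mem' := by
    intro D
    rfl
  smul_mem' := by
    intro z B h D
    simp [h D]

variable {R A}

/-- The differential of a `1`-form,
`(dw)(D, D') = D (w D') - D' (w D) - w [D, D']`. -/
def d₁ (w : Form₁ R A) : Form₂ R A :=
  ⟨LinearMap.mk₂ (Z R A)
    (fun D D' => D.1 (w D') - D'.1 (w D) - w ⁅D, D'⁆)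
    (by
      intro D₁ D₂ D'
      change (D₁.1 + D₂.1) _ - _ - _ = _
      simp only [map_add, LinearMap.add_apply, add_lie]
      abel)
    (by
      intro z D D'
      have hz : ∀ b : A, b * (z : A) = z * b := fun b => Subalgebra.mem_center_iff.1 z.2 b
      have h : ⁅z • D, D'⁆ = z • ⁅D, D'⁆ - Der.onCenter D' z • D := by
        rw [← lie_skew, Der.lie_smul, ← lie_skew D D', smul_neg]
        abel
      rw [h]
      simp only [map_smul, map_sub, Der.smul_apply]
      change _ - D'.1 ((z : A) * w D) - ((z : A) * w ⁅D, D'⁆ - D'.1 z * w D)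
        = (z : A) * (_ - _ - _)
      rw [Der.leibniz D']
      noncomm_ring)
    (by
      intro D D₁ D₂
      change _ - (D₁.1 + D₂.1) _ - _ = _
      simp only [map_add, LinearMap.add_apply, lie_add]
      abel)
    (by
      intro z D D'
      rw [Der.lie_smul]
      simp only [map_smul, map_add, Der.smul_apply]
      change D.1 ((z : A) * w D') - _ - ((z : A) * w ⁅D, D'⁆ + D.1 z * w D')
        = (z : A) * (_ - _ - _)
      rw [Der.leibniz D]
      noncomm_ring), by
    intro D
    simp⟩

/-- The square of a `1`-form in the graded algebra of forms,
`w²(D, D') = w D * w D' - w D' * w D`. -/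
def sq₁ (w : Form₁ R A) : Form₂ R A :=
  ⟨LinearMap.mk₂ (Z R A)
    (fun D D' => w D * w D' - w D' * w D)
    (by
      intro D₁ D₂ D'
      simp only [map_add]
      noncomm_ring)
    (by
      intro z D D'
      have hz : ∀ b : A, b * (z : A) = z * b := fun b => Subalgebra.mem_center_iff.1 z.2 b
      simp only [map_smul]
      change (z : A) * w D * w D' - w D' * ((z : A) * w D) = (z : A) * (_ - _)
      rw [← mul_assoc (w D'), hz]
      noncomm_ring)
    (by
      intro D D₁ D₂
      simp only [map_add]
      noncomm_ring)
    (by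
      intro z D D'
      have hz : ∀ b : A, b * (z : A) = z * b := fun b => Subalgebra.mem_center_iff.1 z.2 b
      simp only [map_smul]
      change w D * ((z : A) * w D') - (z : A) * w D' * w D = (z : A) * (_ - _)
      rw [← mul_assoc (w D), hz]
      noncomm_ring), by
    intro D
    simp⟩

/-- A `2`-form is horizontal for the operation of the inner derivations if it is killed by the
interior products with all inner derivations. -/
def IsHorizontal (B : Form₂ R A) : Prop :=
  ∀ (γ : A) (D : Der R A), B.1 (inner γ) D = 0

end Algebra

end DerCalc

/-! ### Complex vector bundles over a real manifold -/

namespace SUBundle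

open DerCalc

section Bundle

variable (EM : Type*) [NormedAddCommGroup EM] [NormedSpace ℝ EM]
  {M : Type*} [TopologicalSpace M] [ChartedSpace EM M]

/-- Continuity of the complex scalar multiplication implies that of the real one. -/
instance continuousSMul_real {W : Type*} [AddCommGroup W] [Module ℂ W] [TopologicalSpace W]
    [ContinuousSMul ℂ W] : ContinuousSMul ℝ W where
  continuous_smul := by
    have h : Continuous fun p : ℝ × W => ((p.1 : ℂ)) • p.2 :=
      (Complex.continuous_ofReal.comp continuous_fst).smul continuous_snd
    exact h

variable (F : Type*) [NormedAddCommGroup F] [NormedSpace ℂ F]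
  (V : M → Type*) [∀ x, AddCommGroup (V x)] [∀ x, Module ℂ (V x)]
  [TopologicalSpace (TotalSpace F V)] [∀ x, TopologicalSpace (V x)]
  [∀ x, IsTopologicalAddGroup (V x)] [∀ x, ContinuousSMul ℂ (V x)]
  [FiberBundle F V] [VectorBundle ℂ F V] [VectorBundle ℝ F V]
  [ContMDiffVectorBundle ∞ F V 𝓘(ℝ, EM)]

/-- A family of complex-linear endomorphisms of the fibres is smooth if it is a smooth section of
the bundle `Hom(E, E)` (of the underlying real vector bundle). -/
def IsSmoothEnd (S : ∀ x, V x →L[ℂ] V x) : Prop :=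
  ContMDiff 𝓘(ℝ, EM) (𝓘(ℝ, EM).prod 𝓘(ℝ, F →L[ℝ] F)) ∞
    (fun x => TotalSpace.mk' (F →L[ℝ] F) (E := fun x => V x →L[ℝ] V x) x
      ((S x).restrictScalars ℝ))

variable {EM F V}

theorem isSmoothEnd_iff (S : ∀ x, V x →L[ℂ] V x) :
    IsSmoothEnd EM F V S ↔ ∀ x₀, ContMDiffAt 𝓘(ℝ, EM) 𝓘(ℝ, F →L[ℝ] F) ∞
      (fun x => ContinuousLinearMap.inCoordinates F V F V x₀ x x₀ x
        ((S x).restrictScalars ℝ)) x₀ := by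
  refine forall_congr' fun x₀ => ?_
  rw [contMDiffAt_hom_bundle]
  exact and_iff_right contMDiffAt_id

theorem IsSmoothEnd.mul {S T : ∀ x, V x →L[ℂ] V x} (hS : IsSmoothEnd EM F V S)
    (hT : IsSmoothEnd EM F V T) : IsSmoothEnd EM F V (S * T) := by
  rw [isSmoothEnd_iff] at hS hT ⊢
  intro x₀
  refine ((hS x₀).clm_comp (hT x₀)).congr_of_eventuallyEq ?_
  have hmem := (trivializationAt F V x₀).open_baseSet.mem_nhds
    (FiberBundle.mem_baseSet_trivializationAt F V x₀)
  filter_upwards [hmem] with x hx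
  rw [ContinuousLinearMap.inCoordinates_eq hx hx, ContinuousLinearMap.inCoordinates_eq hx hx,
    ContinuousLinearMap.inCoordinates_eq hx hx]
  ext v
  set e := (trivializationAt F V x₀).continuousLinearEquivAt ℝ x hx
  change e (S x (T x (e.symm v))) = e (S x (e.symm (e (T x (e.symm v)))))
  rw [e.symm_apply_apply]

theorem IsSmoothEnd.add {S T : ∀ x, V x →L[ℂ] V x} (hS : IsSmoothEnd EM F V S)
    (hT : IsSmoothEnd EM F V T) : IsSmoothEnd EM F V (S + T) := by
  rw [isSmoothEnd_iff] at hS hT ⊢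
  intro x₀
  refine ((hS x₀).add (hT x₀)).congr_of_eventuallyEq ?_
  have hmem := (trivializationAt F V x₀).open_baseSet.mem_nhds
    (FiberBundle.mem_baseSet_trivializationAt F V x₀)
  filter_upwards [hmem] with x hx
  rw [Pi.add_apply, Pi.add_apply, ContinuousLinearMap.inCoordinates_eq hx hx,
    ContinuousLinearMap.inCoordinates_eq hx hx, ContinuousLinearMap.inCoordinates_eq hx hx]
  ext v
  set e := (trivializationAt F V x₀).continuousLinearEquivAt ℝ x hx
  change e (S x (e.symm v) + T x (e.symm v)) = e (S x (e.symm v)) + e (T x (e.symm v))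
  rw [e.map_add]

theorem isSmoothEnd_scalar {f : M → ℂ} (hf : ContMDiff 𝓘(ℝ, EM) 𝓘(ℝ, ℂ) ∞ f) :
    IsSmoothEnd EM F V (fun x => f x • (1 : V x →L[ℂ] V x)) := by
  rw [isSmoothEnd_iff]
  intro x₀
  have h : ContMDiffAt 𝓘(ℝ, EM) 𝓘(ℝ, F →L[ℝ] F) ∞
      (fun x => (ContinuousLinearMap.lsmul ℝ ℂ : ℂ →L[ℝ] F →L[ℝ] F) (f x)) x₀ :=
    (ContinuousLinearMap.contMDiff _).contMDiffAt.comp x₀ hf.contMDiffAt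
  refine h.congr_of_eventuallyEq ?_
  have hmem := (trivializationAt F V x₀).open_baseSet.mem_nhds
    (FiberBundle.mem_baseSet_trivializationAt F V x₀)
  filter_upwards [hmem] with x hx
  rw [ContinuousLinearMap.inCoordinates_eq hx hx]
  ext v
  set e := (trivializationAt F V x₀).continuousLinearEquivAt ℝ x hx with he
  have hc : ∀ (c : ℂ) (w : V x), e (c • w) = c • e w :=
    fun c w => ((trivializationAt F V x₀).linear ℂ hx).map_smul c w
  change e (f x • e.symm v) = f x • v
  rw [hc, e.apply_symm_apply]

variable (EM F V)

/-- The unital algebra of smooth sections of `End(E)`. -/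
def EndAlg : Subalgebra ℂ (∀ x, V x →L[ℂ] V x) where
  carrier := {S | IsSmoothEnd EM F V S}
  mul_mem' := IsSmoothEnd.mul
  add_mem' := IsSmoothEnd.add
  algebraMap_mem' c := isSmoothEnd_scalar (f := fun _ => c) contMDiff_const

/-- The space `Γ(E)` of smooth sections. -/
abbrev Sec : Type _ := Cₛ^∞⟮𝓘(ℝ, EM); F, V⟯

variable {EM F V}

/-- The endomorphism `f • 1` for a smooth complex function `f`. -/
def scalar (f : C^∞⟮𝓘(ℝ, EM), M; 𝓘(ℝ, ℂ), ℂ⟯) : EndAlg EM F V :=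
  ⟨fun x => f x • 1, isSmoothEnd_scalar f.contMDiff⟩

/-- The action of an endomorphism field on a (not necessarily smooth) section. -/
def act (S : EndAlg EM F V) (s : ∀ x, V x) : ∀ x, V x := fun x => S.1 x (s x)

/-! ### Complex vector fields -/

variable (EM M) in
/-- A smooth complex vector field `X = re + i im`, a section of `TM ⊗ ℂ`. -/
structure CVectorField [IsManifold 𝓘(ℝ, EM) ∞ M] where
  re : Cₛ^∞⟮𝓘(ℝ, EM); EM, (TangentSpace 𝓘(ℝ, EM) : M → Type _)⟯
  im : Cₛ^∞⟮𝓘(ℝ, EM); EM, (TangentSpace 𝓘(ℝ, EM) : M → Type _)⟯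

variable [IsManifold 𝓘(ℝ, EM) ∞ M]

/-- The derivative `X f` of a complex function along a complex vector field. -/
def CVectorField.deriv (X : CVectorField EM M) (f : M → ℂ) (x : M) : ℂ :=
  mvfderiv 𝓘(ℝ, EM) f x (X.re x) + Complex.I * mvfderiv 𝓘(ℝ, EM) f x (X.im x)

/-- The Lie bracket of smooth vector fields, as a smooth vector field. -/
def lieBracketSec [FiniteDimensional ℝ EM]
    (X Y : Cₛ^∞⟮𝓘(ℝ, EM); EM, (TangentSpace 𝓘(ℝ, EM) : M → Type _)⟯) :
    Cₛ^∞⟮𝓘(ℝ, EM); EM, (TangentSpace 𝓘(ℝ, EM) : M → Type _)⟯ :=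
  ⟨mlieBracket 𝓘(ℝ, EM) X Y, by
    have : CompleteSpace EM := FiniteDimensional.complete ℝ EM
    have : IsManifold 𝓘(ℝ, EM) (minSmoothness ℝ 2) M :=
      IsManifold.of_le (n := ∞) (by
        simp only [minSmoothness_of_isRCLikeNormedField]
        exact (mod_cast le_top : ((2 : ℕ∞) : WithTop ℕ∞) ≤ ∞))
    have : IsManifold 𝓘(ℝ, EM) (((⊤ : ℕ∞) : WithTop ℕ∞) + 1) M := by simpa
    exact ContDiff.mlieBracket_vectorField (m := ⊤) (n := ⊤) X.contMDiff Y.contMDiff (by simp)⟩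

/-- The complex bilinear extension of the Lie bracket of vector fields. -/
def CVectorField.bracket [FiniteDimensional ℝ EM] (X Y : CVectorField EM M) :
    CVectorField EM M where
  re := lieBracketSec X.re Y.re - lieBracketSec X.im Y.im
  im := lieBracketSec X.re Y.im + lieBracketSec X.im Y.re

/-- The complex vector field `X` is the image of the derivation `D` of `Γ(End(E))`: the derivation
sends `f • 1` to `(X f) • 1` for every smooth complex function `f`. -/
def IsImage (D : Der ℂ (EndAlg EM F V)) (X : CVectorField EM M) : Prop :=
  ∀ (f : C^∞⟮𝓘(ℝ, EM), M; 𝓘(ℝ, ℂ), ℂ⟯) (x : M),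
    (D.1 (scalar f)).1 x = X.deriv f x • (1 : V x →L[ℂ] V x)

/-! ### The `SU(n)`-structure and connections -/

variable (EM F V) in
/-- An `SU(n)`-structure on a complex vector bundle `E` of rank `n`: a smooth hermitian metric on
`E`, and a trivialization of the line bundle `Λⁿ E`. The latter is given by a smooth family `vol`
of nonzero alternating `n`-linear forms on the fibres, i.e. of linear isomorphisms from `Λⁿ (V x)`
to `ℂ`. -/
structure SUStructure (n : ℕ) where
  /-- the hermitian metric, antilinear in the first argument -/
  metric : ∀ x, V x →ₗ⋆[ℂ] V x →ₗ[ℂ] ℂ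
  metric_symm : ∀ x v w, metric x w v = (starRingEnd ℂ) (metric x v w)
  metric_pos : ∀ x v, v ≠ 0 → 0 < (metric x v v).re
  metric_smooth : ∀ s t : Sec EM F V,
    ContMDiff 𝓘(ℝ, EM) 𝓘(ℝ, ℂ) ∞ (fun x => metric x (s x) (t x))
  /-- the trivialization of `Λⁿ E` -/
  vol : ∀ x, V x [⋀^Fin n]→ₗ[ℂ] ℂ
  vol_ne_zero : ∀ x, vol x ≠ 0
  vol_smooth : ∀ s : Fin n → Sec EM F V,
    ContMDiff 𝓘(ℝ, EM) 𝓘(ℝ, ℂ) ∞ (fun x => vol x (fun i => s i x))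

/-- A covariant derivative is complex linear in the section. -/
def IsComplexLinear (nabla : CovariantDerivative 𝓘(ℝ, EM) F V) : Prop :=
  ∀ (c : ℂ) (s : Sec EM F V) (x : M) (v : TangentSpace 𝓘(ℝ, EM) x),
    nabla (fun y => c • s y) x v = c • nabla s x v

/-- A covariant derivative is compatible with the given trivialization of `Λⁿ E`:
`v (vol (s₁, …, sₙ)) = ∑ᵢ vol (s₁, …, ∇_v sᵢ, …, sₙ)`. -/
def PreservesVolume {n : ℕ} (su : SUStructure EM F V n)
    (nabla : CovariantDerivative 𝓘(ℝ, EM) F V) : Prop :=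
  ∀ (s : Fin n → Sec EM F V) (x : M) (v : TangentSpace 𝓘(ℝ, EM) x),
    mvfderiv 𝓘(ℝ, EM) (fun y => su.vol y (fun i => s i y)) x v
      = ∑ i, su.vol x (Function.update (fun j => s j x) i (nabla (s i) x v))

/-- The complex linear extension of a connection to complex vector fields: `∇_X s`. -/
def cov (nabla : CovariantDerivative 𝓘(ℝ, EM) F V) (X : CVectorField EM M) (s : ∀ x, V x) :
    ∀ x, V x :=
  fun x => nabla s x (X.re x) + Complex.I • nabla s x (X.im x)

/-- The curvature `R(X, Y) s = ∇_X ∇_Y s - ∇_Y ∇_X s - ∇_[X, Y] s`. -/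
def curvature [FiniteDimensional ℝ EM] (nabla : CovariantDerivative 𝓘(ℝ, EM) F V)
    (X Y : CVectorField EM M) (s : ∀ x, V x) : ∀ x, V x :=
  cov nabla X (cov nabla Y s) - cov nabla Y (cov nabla X s) - cov nabla (X.bracket Y) s

/-- The induced connection on `End(E)`, evaluated on a section:
`(∇_X S) s = ∇_X (S s) - S (∇_X s)`. -/
def covEnd (nabla : CovariantDerivative 𝓘(ℝ, EM) F V) (X : CVectorField EM M)
    (S : EndAlg EM F V) (s : ∀ x, V x) : ∀ x, V x :=
  cov nabla X (act S s) - act S (cov nabla X s)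

/-- The noncommutative `1`-form `a` is the one associated to the connection: it has traceless
values, and every derivation `D` with image `X` decomposes as `D = ∇_X - [a(D), ·]`, where `∇` is
the induced connection on `End(E)`. -/
def IsAssociated (nabla : CovariantDerivative 𝓘(ℝ, EM) F V)
    (a : Form₁ ℂ (EndAlg EM F V)) : Prop :=
  (∀ D x, LinearMap.trace ℂ (V x) ((a D).1 x).toLinearMap = 0) ∧
    ∀ D X, IsImage D X → ∀ (S : EndAlg EM F V) (s : Sec EM F V),
      act (D.1 S) s = covEnd nabla X S s - act ⁅a D, S⁆ s

end Bundle

end SUBundle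

end

-- On a fibre, `End(E)` is a full matrix algebra: its centre consists of the scalars and its
-- derivations are inner, each with exactly one traceless generator because the rank is positive.
-- The theorem spreads these facts over `M`. Bump functions reduce global operators to local ones,
-- and a local frame supplies the matrix units.
--
-- Image. A derivation `D` preserves the centre, so it sends `f • 1` to a scalar field and induces a
-- derivation of the smooth complex functions. By Hadamard's lemma such a derivation is a complex
-- vector field (`exists_cVectorField`). Testing on coordinate functions shows that this field is
-- unique.
--
-- Associated form. If `X` is the image of `D`, then `∇_X` is also a derivation of `Γ(End(E))` with
-- image `X`, so `∇_X - D` annihilates the scalars. In a local frame with matrix units `E_ij` and a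
-- fixed index `o`, a derivation `Δ` annihilating the scalars is the commutator with `∑ j, Δ(E_jo)
-- E_oj` (`exists_locally_inner`). The traceless parts of these local generators are forced, hence
-- they glue to a global field `α(D)`. The same rigidity gives uniqueness of `α` and its linearity
-- over the centre (`eq_of_commutator_eq`, `connForm_smul_add`).
--
-- Curvature. Since traceless fields are determined by their commutators, it suffices that `R(X, Y)`
-- and `dα(D, D') + [α(D), α(D')]` are traceless and have the same commutators. The commutator with
-- `R(X, Y)` is the curvature of the induced connection. Substituting `∇_X = D + [α(D), ·]` into
-- that curvature produces the commutator with the second field, because the image of `[D, D']` is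
-- `[X, Y]`. The trace of `R` is the curvature of the determinant line, which vanishes because the
-- connection preserves a nowhere zero volume (`trace_curvature`). The second field is traceless
-- because `tr (∇_X S) = X (tr S)`, so that derivations preserve tracelessness (`trace_der`).
--
-- Horizontality. Inner derivations have image `0`, and `R(0, Y) = 0`.

universe u

/-! ### Hadamard's lemma -/

/-- Integrals of a smooth function along rays depend smoothly on the ray. -/
theorem contDiff_integral_pow_smul_comp_smul {E : Type u} [NormedAddCommGroup E] [NormedSpace ℝ E]
    [FiniteDimensional ℝ E] (n : ℕ) {G : Type u} [NormedAddCommGroup G] [NormedSpace ℝ G]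
    [CompleteSpace G] {φ : E → G} (hφ : ContDiff ℝ n φ) (k : ℕ) :
    ContDiff ℝ n (fun y => ∫ t in (0 : ℝ)..1, t ^ k • φ (t • y)) := by
  -- Differentiating under the integral replaces `φ` by `fderiv ℝ φ` and brings out a factor `t`. So
  -- the target and the exponent change along the induction, and `G` shares the universe of `E` to
  -- make room for `E →L[ℝ] G`.
  induction n generalizing G k with
  | zero =>
    rw [Nat.cast_zero, contDiff_zero] at hφ ⊢
    refine intervalIntegral.continuous_parametric_intervalIntegral_of_continuous' ?_ 0 1
    fun_prop
  | succ n ih =>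
    have hd : Differentiable ℝ φ := hφ.differentiable (by simp)
    have hc : Continuous φ := hd.continuous
    have hφ' : ContDiff ℝ n (fderiv ℝ φ) := hφ.fderiv_right (by simp)
    have hc' : Continuous (fderiv ℝ φ) := hφ'.continuous
    have key : ∀ y₀ : E, HasFDerivAt (fun y => ∫ t in (0 : ℝ)..1, t ^ k • φ (t • y))
        (∫ t in (0 : ℝ)..1, t ^ (k + 1) • fderiv ℝ φ (t • y₀)) y₀ := by
      intro y₀
      have hcont : Continuous (fun p : ℝ × E => ‖p.1 ^ (k + 1) • fderiv ℝ φ (p.1 • p.2)‖) := by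
        fun_prop
      -- The dominating constant: a continuous function is bounded on the compact product of `[0,
      -- 1]` with a closed ball around `y₀`.
      obtain ⟨C, hC⟩ := ((isCompact_Icc (a := (0 : ℝ)) (b := 1)).prod
        (isCompact_closedBall y₀ 1)).bddAbove_image hcont.continuousOn
      refine intervalIntegral.hasFDerivAt_integral_of_dominated_of_fderiv_le
        (F := fun y t => t ^ k • φ (t • y))
        (F' := fun y t => t ^ (k + 1) • fderiv ℝ φ (t • y)) (bound := fun _ => C)
        (Metric.closedBall_mem_nhds y₀ one_pos) ?_ ?_ ?_ ?_ ?_ ?_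
      · refine Filter.Eventually.of_forall fun y => Continuous.aestronglyMeasurable ?_
        fun_prop
      · refine Continuous.intervalIntegrable ?_ _ _
        fun_prop
      · have : SecondCountableTopologyEither ℝ (E →L[ℝ] G) := secondCountableTopologyEither_of_left _ _
        have h : Continuous fun t : ℝ => t ^ (k + 1) • fderiv ℝ φ (t • y₀) := by fun_prop
        exact h.aestronglyMeasurable
      · refine Filter.Eventually.of_forall fun t ht y hy => ?_
        rw [Set.uIoc_of_le zero_le_one] at ht
        exact hC ⟨(t, y), ⟨⟨ht.1.le, ht.2⟩, hy⟩, rfl⟩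
      · exact intervalIntegrable_const
      · refine Filter.Eventually.of_forall fun t _ y _ => ?_
        have h1 : HasFDerivAt (fun y : E => t • y) (t • ContinuousLinearMap.id ℝ E) y :=
          (hasFDerivAt_id y).const_smul t
        have h2 := (((hd (t • y)).hasFDerivAt).comp y h1).const_smul (t ^ k)
        convert! h2 using 1
        ext v
        simp [pow_succ, smul_smul]
    have hf : fderiv ℝ (fun y => ∫ t in (0 : ℝ)..1, t ^ k • φ (t • y))
        = fun y => ∫ t in (0 : ℝ)..1, t ^ (k + 1) • fderiv ℝ φ (t • y) :=
      funext fun y => (key y).fderiv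
    rw [Nat.cast_succ, contDiff_succ_iff_fderiv]
    refine ⟨fun y => (key y).differentiableAt, by simp, ?_⟩
    rw [hf]
    exact ih hφ' (k + 1)

/-- Hadamard's lemma. -/
theorem ContDiff.exists_eq_add_clm_apply {E : Type u} [NormedAddCommGroup E] [NormedSpace ℝ E]
    [FiniteDimensional ℝ E] {f : E → ℂ} (hf : ContDiff ℝ ∞ f) :
    ∃ g : E → E →L[ℝ] ℂ, ContDiff ℝ ∞ g ∧ g 0 = fderiv ℝ f 0 ∧ ∀ y, f y = f 0 + g y y := by
  have hf' : ContDiff ℝ ∞ (fderiv ℝ f) := hf.fderiv_right (by simp)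
  -- The fundamental theorem of calculus along the ray from `0` to `y` gives `f y - f 0` as the
  -- integral of `fderiv ℝ f (t • y) y`.
  refine ⟨fun y => ∫ t in (0 : ℝ)..1, fderiv ℝ f (t • y), ?_, by simp, fun y => ?_⟩
  · refine contDiff_infty.2 fun n => ?_
    simpa using contDiff_integral_pow_smul_comp_smul n (contDiff_infty.1 hf' n) 0
  · have hd : ∀ t : ℝ, HasDerivAt (fun t : ℝ => f (t • y)) (fderiv ℝ f (t • y) y) t := by
      intro t
      have h1 : HasDerivAt (fun t : ℝ => t • y) y t := by
        simpa using (hasDerivAt_id t).smul_const y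
      exact ((hf.differentiable (by simp)) (t • y)).hasFDerivAt.comp_hasDerivAt t h1
    have hc : Continuous fun t : ℝ => fderiv ℝ f (t • y) := by
      have := hf'.continuous
      fun_prop
    have h := intervalIntegral.integral_eq_sub_of_hasDerivAt (a := 0) (b := 1)
      (fun t _ => hd t) ((hc.clm_apply continuous_const).intervalIntegrable 0 1)
    rw [ContinuousLinearMap.intervalIntegral_apply (hc.intervalIntegrable 0 1), h]
    simp


/-! ### Bump functions and derivations at a point -/

namespace SUBundle

section VectorFields

open scoped Topology

variable {EM : Type*} [NormedAddCommGroup EM] [NormedSpace ℝ EM]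
  {M : Type*} [TopologicalSpace M] [ChartedSpace EM M]

theorem contMDiffAt_mul {f g : M → ℂ} {x : M} (hf : ContMDiffAt 𝓘(ℝ, EM) 𝓘(ℝ, ℂ) ∞ f x)
    (hg : ContMDiffAt 𝓘(ℝ, EM) 𝓘(ℝ, ℂ) ∞ g x) :
    ContMDiffAt 𝓘(ℝ, EM) 𝓘(ℝ, ℂ) ∞ (fun y => f y * g y) x :=
  (contDiff_mul (𝕜 := ℝ) (𝔸 := ℂ) (n := ∞)).contDiffAt.comp_contMDiffAt (hf.prodMk_space hg)

theorem contMDiff_mul {f g : M → ℂ} (hf : ContMDiff 𝓘(ℝ, EM) 𝓘(ℝ, ℂ) ∞ f)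
    (hg : ContMDiff 𝓘(ℝ, EM) 𝓘(ℝ, ℂ) ∞ g) :
    ContMDiff 𝓘(ℝ, EM) 𝓘(ℝ, ℂ) ∞ (fun y => f y * g y) :=
  fun x => contMDiffAt_mul (hf x) (hg x)

theorem contMDiff_ofReal {f : M → ℝ} (hf : ContMDiff 𝓘(ℝ, EM) 𝓘(ℝ, ℝ) ∞ f) :
    ContMDiff 𝓘(ℝ, EM) 𝓘(ℝ, ℂ) ∞ (fun y => (f y : ℂ)) :=
  Complex.ofRealCLM.contDiff.comp_contMDiff hf

variable [FiniteDimensional ℝ EM] [T2Space M] [IsManifold 𝓘(ℝ, EM) ∞ M]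

/-- Smooth bump functions, supported in a given neighbourhood. -/
theorem exists_contMDiff_bump {x : M} {U : Set M} (hU : U ∈ 𝓝 x) :
    ∃ ψ : M → ℝ, ContMDiff 𝓘(ℝ, EM) 𝓘(ℝ, ℝ) ∞ ψ ∧ (∀ᶠ y in 𝓝 x, ψ y = 1) ∧ tsupport ψ ⊆ U := by
  obtain ⟨f, -, hf⟩ := (SmoothBumpFunction.nhds_basis_tsupport (I := 𝓘(ℝ, EM)) x).mem_iff.1 hU
  exact ⟨f, f.contMDiff, f.eventuallyEq_one, hf⟩

theorem contMDiff_smul_of_tsupport {G : Type*} [NormedAddCommGroup G] [NormedSpace ℝ G]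
    {ψ : M → ℝ} (hψ : ContMDiff 𝓘(ℝ, EM) 𝓘(ℝ, ℝ) ∞ ψ) {U : Set M} (hU : IsOpen U)
    (hs : tsupport ψ ⊆ U) {g : M → G} (hg : ContMDiffOn 𝓘(ℝ, EM) 𝓘(ℝ, G) ∞ g U) :
    ContMDiff 𝓘(ℝ, EM) 𝓘(ℝ, G) ∞ (fun y => ψ y • g y) := by
  refine contMDiff_of_tsupport fun x hx => ?_
  have hx' : x ∈ U := hs (tsupport_smul_subset_left _ _ hx)
  exact (hψ x).smul ((hg x hx').contMDiffAt (hU.mem_nhds hx'))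

/-- A function which is smooth near a point coincides near the point with a globally smooth one. -/
theorem exists_contMDiff_eventuallyEq {G : Type*} [NormedAddCommGroup G] [NormedSpace ℝ G]
    {x : M} {U : Set M} (hU : IsOpen U) (hx : x ∈ U) {g : M → G}
    (hg : ContMDiffOn 𝓘(ℝ, EM) 𝓘(ℝ, G) ∞ g U) :
    ∃ h : M → G, ContMDiff 𝓘(ℝ, EM) 𝓘(ℝ, G) ∞ h ∧ ∀ᶠ y in 𝓝 x, h y = g y := by
  obtain ⟨ψ, hψ, h1, hs⟩ := exists_contMDiff_bump (EM := EM) (hU.mem_nhds hx)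
  exact ⟨_, contMDiff_smul_of_tsupport hψ hU hs hg, h1.mono fun y hy => by rw [hy, one_smul]⟩

/-- `δ` is a derivation at `x` of the algebra of smooth complex functions. -/
structure IsPointDerivation (x : M) (δ : C^∞⟮𝓘(ℝ, EM), M; 𝓘(ℝ, ℂ), ℂ⟯ → ℂ) : Prop where
  add : ∀ f g h : C^∞⟮𝓘(ℝ, EM), M; 𝓘(ℝ, ℂ), ℂ⟯, (∀ y, h y = f y + g y) → δ h = δ f + δ g
  mul : ∀ f g h : C^∞⟮𝓘(ℝ, EM), M; 𝓘(ℝ, ℂ), ℂ⟯, (∀ y, h y = f y * g y) →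
    δ h = δ f * g x + f x * δ g
  const : ∀ (f : C^∞⟮𝓘(ℝ, EM), M; 𝓘(ℝ, ℂ), ℂ⟯) (c : ℂ), (∀ y, f y = c) → δ f = 0

namespace IsPointDerivation

variable {x : M} {δ : C^∞⟮𝓘(ℝ, EM), M; 𝓘(ℝ, ℂ), ℂ⟯ → ℂ}

/-- If `ψ` is a bump function at `x` supported where `f = g`, then `ψ f = ψ g`. Expanding `δ` of
this product by the Leibniz rule in both ways, with `ψ x = 1` and `f x = g x`, gives the claim. -/
theorem congr (hδ : IsPointDerivation x δ) {f g : C^∞⟮𝓘(ℝ, EM), M; 𝓘(ℝ, ℂ), ℂ⟯}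
    (h : ∀ᶠ y in 𝓝 x, f y = g y) : δ f = δ g := by
  obtain ⟨ψ, hψ, h1, hs⟩ := exists_contMDiff_bump (EM := EM) h
  have hx : ψ x = 1 := h1.self_of_nhds
  let p : C^∞⟮𝓘(ℝ, EM), M; 𝓘(ℝ, ℂ), ℂ⟯ := ⟨fun y => (ψ y : ℂ), contMDiff_ofReal hψ⟩
  let k : C^∞⟮𝓘(ℝ, EM), M; 𝓘(ℝ, ℂ), ℂ⟯ := ⟨fun y => (ψ y : ℂ) * f y,
    contMDiff_mul (contMDiff_ofReal hψ) f.contMDiff⟩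
  have e1 : δ k = δ p * f x + p x * δ f := hδ.mul p f k fun y => rfl
  have e2 : δ k = δ p * g x + p x * δ g := by
    refine hδ.mul p g k fun y => ?_
    by_cases hy : y ∈ tsupport ψ
    · have : f y = g y := hs hy
      simp [k, p, this]
    · simp [k, p, image_eq_zero_of_notMem_tsupport hy]
  have hp : p x = 1 := by simp [p, hx]
  have hfg : f x = g x := h.self_of_nhds
  rw [e1, hp, hfg] at e2
  simpa using e2

/-- The right hand side has the shape of a Hadamard expansion: a constant plus a sum of products of
two functions. -/
theorem sum (hδ : IsPointDerivation x δ) {ι : Type*} (s : Finset ι)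
    (f g : ι → C^∞⟮𝓘(ℝ, EM), M; 𝓘(ℝ, ℂ), ℂ⟯) (h : C^∞⟮𝓘(ℝ, EM), M; 𝓘(ℝ, ℂ), ℂ⟯) (c : ℂ)
    (hh : ∀ y, h y = c + ∑ i ∈ s, f i y * g i y) :
    δ h = ∑ i ∈ s, (δ (f i) * g i x + f i x * δ (g i)) := by
  classical
  induction s using Finset.induction_on generalizing h with
  | empty => simpa using hδ.const h c (by simpa using hh)
  | insert i s hi ih =>
    have hk : ContMDiff 𝓘(ℝ, EM) 𝓘(ℝ, ℂ) ∞ fun y => c + ∑ j ∈ s, f j y * g j y :=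
      contMDiff_const.add (contMDiff_finsetSum fun j _ =>
        contMDiff_mul (f j).contMDiff (g j).contMDiff)
    rw [Finset.sum_insert hi, hδ.add ⟨fun y => f i y * g i y,
      contMDiff_mul (f i).contMDiff (g i).contMDiff⟩ ⟨_, hk⟩ h
      fun y => by rw [hh, Finset.sum_insert hi]; simp; ring]
    rw [ih ⟨_, hk⟩ fun y => rfl, hδ.mul (f i) (g i) ⟨fun y => f i y * g i y,
      contMDiff_mul (f i).contMDiff (g i).contMDiff⟩ fun y => rfl]

/-- A derivation at a point of the algebra of smooth complex functions is given by a complex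
tangent vector. -/
theorem exists_eq_mvfderiv (hδ : IsPointDerivation x δ) :
    ∃ u w : TangentSpace 𝓘(ℝ, EM) x, ∀ f : C^∞⟮𝓘(ℝ, EM), M; 𝓘(ℝ, ℂ), ℂ⟯,
      δ f = mvfderiv 𝓘(ℝ, EM) f x u + Complex.I * mvfderiv 𝓘(ℝ, EM) f x w := by
  let φ := extChartAt 𝓘(ℝ, EM) x
  have hsrc : IsOpen φ.source := isOpen_extChartAt_source x
  have hxs : x ∈ φ.source := mem_extChartAt_source x
  have hφ : ContMDiffOn 𝓘(ℝ, EM) 𝓘(ℝ, EM) ∞ φ φ.source := by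
    rw [extChartAt_source]
    exact contMDiffOn_extChartAt
  let b := Module.finBasis ℝ EM
  let c : Fin (Module.finrank ℝ EM) → EM →L[ℝ] ℝ := fun i => (b.coord i).toContinuousLinearMap
  have hb : ∀ v, v = ∑ i, c i v • b i := fun v => (b.sum_repr v).symm
  have hUφ : ∀ i, ContMDiffOn 𝓘(ℝ, EM) 𝓘(ℝ, ℂ) ∞ (fun y => ((c i (φ y - φ x) : ℝ) : ℂ))
      φ.source := fun i => by
    have h : ContDiff ℝ ∞ fun z : EM => ((c i (z - φ x) : ℝ) : ℂ) :=
      Complex.ofRealCLM.contDiff.comp ((c i).contDiff.comp (contDiff_id.sub contDiff_const))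
    exact h.contMDiff.comp_contMDiffOn hφ
  choose u hu hu' using fun i => exists_contMDiff_eventuallyEq hsrc hxs (hUφ i)
  let U : Fin (Module.finrank ℝ EM) → C^∞⟮𝓘(ℝ, EM), M; 𝓘(ℝ, ℂ), ℂ⟯ := fun i => ⟨u i, hu i⟩
  -- Near `x`, Hadamard's lemma in a chart gives `f = f x + ∑ i, U i * W i`, where `U i` vanishes at
  -- `x` and `W i x` is the `i`-th partial derivative of `f`. The Leibniz rule leaves only the terms
  -- `δ (U i) * W i x`.
  have key : ∀ f : C^∞⟮𝓘(ℝ, EM), M; 𝓘(ℝ, ℂ), ℂ⟯,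
      δ f = ∑ i, δ (U i) * mvfderiv 𝓘(ℝ, EM) f x (b i) := by
    intro f
    have htgt : IsOpen φ.target := isOpen_extChartAt_target x
    -- Hadamard's lemma integrates along rays in the whole model space, so the chart expression of
    -- `f` is first replaced by a function smooth everywhere with the same germ.
    obtain ⟨F, hF, hF'⟩ := exists_contMDiff_eventuallyEq (EM := EM) htgt
      (mem_extChartAt_target x) (f.contMDiff.comp_contMDiffOn (contMDiffOn_extChartAt_symm x))
    have hF1 : ContDiff ℝ ∞ (fun z => F (φ x + z)) :=
      (contMDiff_iff_contDiff.1 hF).comp (contDiff_const.add contDiff_id)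
    obtain ⟨g, hg, hg0, hgz⟩ := hF1.exists_eq_add_clm_apply
    have hVφ : ∀ i, ContMDiffOn 𝓘(ℝ, EM) 𝓘(ℝ, ℂ) ∞ (fun y => g (φ y - φ x) (b i)) φ.source :=
      fun i => by
        have h : ContDiff ℝ ∞ fun z : EM => g (z - φ x) (b i) :=
          (hg.comp (contDiff_id.sub contDiff_const)).clm_apply contDiff_const
        exact h.contMDiff.comp_contMDiffOn hφ
    choose v hv hv' using fun i => exists_contMDiff_eventuallyEq hsrc hxs (hVφ i)
    let W : Fin (Module.finrank ℝ EM) → C^∞⟮𝓘(ℝ, EM), M; 𝓘(ℝ, ℂ), ℂ⟯ := fun i => ⟨v i, hv i⟩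
    have hk : ContMDiff 𝓘(ℝ, EM) 𝓘(ℝ, ℂ) ∞ fun y => f x + ∑ i, U i y * W i y :=
      contMDiff_const.add (contMDiff_finsetSum fun j _ =>
        contMDiff_mul (U j).contMDiff (W j).contMDiff)
    let K : C^∞⟮𝓘(ℝ, EM), M; 𝓘(ℝ, ℂ), ℂ⟯ := ⟨_, hk⟩
    have hFx : F (φ x) = f x := by
      rw [hF'.self_of_nhds]
      exact congrArg f (extChartAt_to_inv x)
    have hloc : ∀ᶠ y in 𝓝 x, f y = K y := by
      filter_upwards [hsrc.mem_nhds hxs, Filter.eventually_all.2 hu', Filter.eventually_all.2 hv',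
        (continuousAt_extChartAt x).eventually hF'] with y hy h1 h2 h3
      change f y = f x + ∑ i, u i y * v i y
      have h4 : f y = F (φ y) := by
        rw [h3]
        exact congrArg f (φ.left_inv hy).symm
      have h5 := hgz (φ y - φ x)
      simp only [add_sub_cancel, add_zero, hFx] at h5
      rw [h4, h5]
      congr 1
      have h6 : ∀ (l : EM →L[ℝ] ℂ) (z : EM), l z = ∑ i, ((c i z : ℝ) : ℂ) * l (b i) := by
        intro l z
        conv_lhs => rw [hb z]
        rw [map_sum]
        exact Finset.sum_congr rfl fun i _ => (l.map_smul _ _).trans Complex.real_smul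
      rw [h6]
      exact Finset.sum_congr rfl fun i _ => by rw [h1, h2]
    rw [hδ.congr hloc, hδ.sum Finset.univ U W K (f x) fun y => rfl]
    refine Finset.sum_congr rfl fun i _ => ?_
    have e1 : U i x = 0 := by
      change u i x = 0
      rw [(hu' i).self_of_nhds]
      simp
    have e2 : W i x = mvfderiv 𝓘(ℝ, EM) f x (b i) := by
      change v i x = _
      rw [(hv' i).self_of_nhds, sub_self, hg0, f.contMDiff.mdifferentiableAt (by simp) |>.mvfderiv]
      have h6 : fderiv ℝ (fun z => F (φ x + z)) 0 = fderiv ℝ F (φ x) := by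
        rw [fderiv_comp_add_left, add_zero]
      rw [h6, ModelWithCorners.range_eq_univ, fderivWithin_univ]
      have h7 : F =ᶠ[𝓝 (φ x)] writtenInExtChartAt 𝓘(ℝ, EM) 𝓘(ℝ, ℂ) x f := hF'
      rw [h7.fderiv_eq]
      rfl
    rw [e1, e2]
    ring
  -- The complex coefficients `δ (U i)` are split into real and imaginary parts to obtain two real
  -- tangent vectors.
  refine ⟨∑ i, (δ (U i)).re • (b i : EM), ∑ i, (δ (U i)).im • (b i : EM), fun f => ?_⟩
  rw [key f]
  have hl : ∀ r : Fin (Module.finrank ℝ EM) → ℝ, mvfderiv 𝓘(ℝ, EM) f x (∑ i, r i • (b i : EM))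
      = ∑ i, (r i : ℂ) * mvfderiv 𝓘(ℝ, EM) f x (b i) := fun r =>
    (map_sum (mvfderiv 𝓘(ℝ, EM) f x) _ _).trans (Finset.sum_congr rfl fun i _ =>
      ((mvfderiv 𝓘(ℝ, EM) f x).map_smul (r i) _).trans Complex.real_smul)
  rw [hl, hl, Finset.mul_sum, ← Finset.sum_add_distrib]
  refine Finset.sum_congr rfl fun i _ => ?_
  rw [← mul_assoc, ← add_mul, mul_comm Complex.I, Complex.re_add_im]

end IsPointDerivation

end VectorFields

end SUBundle

/-! ### Smooth complex vector fields and their action on functions -/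

namespace SUBundle

section VectorFields

open scoped Topology

variable {EM : Type*} [NormedAddCommGroup EM] [NormedSpace ℝ EM]
  {M : Type*} [TopologicalSpace M] [ChartedSpace EM M]

theorem mvfderiv_congr {G : Type*} [NormedAddCommGroup G] [NormedSpace ℝ G] {f g : M → G} {x : M}
    (h : f =ᶠ[𝓝 x] g) : mvfderiv 𝓘(ℝ, EM) f x = mvfderiv 𝓘(ℝ, EM) g x := by
  ext v
  exact DFunLike.congr_fun (h.mfderiv_eq (I := 𝓘(ℝ, EM)) (I' := 𝓘(ℝ, G))) v

theorem mvfderiv_fderiv_comp {G G' : Type*} [NormedAddCommGroup G] [NormedSpace ℝ G]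
    [NormedAddCommGroup G'] [NormedSpace ℝ G'] {L : G → G'} {f : M → G} {x : M}
    (hL : DifferentiableAt ℝ L (f x)) (hf : MDifferentiableAt 𝓘(ℝ, EM) 𝓘(ℝ, G) f x)
    (v : TangentSpace 𝓘(ℝ, EM) x) :
    mvfderiv 𝓘(ℝ, EM) (fun y => L (f y)) x v = fderiv ℝ L (f x) (mvfderiv 𝓘(ℝ, EM) f x v) := by
  have h := hL.hasFDerivAt.hasMFDerivAt.comp x hf.hasMFDerivAt
  exact DFunLike.congr_fun h.mfderiv v

theorem mvfderiv_clm_comp {G G' : Type*} [NormedAddCommGroup G] [NormedSpace ℝ G]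
    [NormedAddCommGroup G'] [NormedSpace ℝ G'] (L : G →L[ℝ] G') {f : M → G} {x : M}
    (hf : MDifferentiableAt 𝓘(ℝ, EM) 𝓘(ℝ, G) f x) (v : TangentSpace 𝓘(ℝ, EM) x) :
    mvfderiv 𝓘(ℝ, EM) (fun y => L (f y)) x v = L (mvfderiv 𝓘(ℝ, EM) f x v) := by
  rw [mvfderiv_fderiv_comp L.differentiableAt hf, L.fderiv]

theorem mvfderiv_complex_mul {f g : M → ℂ} {x : M}
    (hf : MDifferentiableAt 𝓘(ℝ, EM) 𝓘(ℝ, ℂ) f x) (hg : MDifferentiableAt 𝓘(ℝ, EM) 𝓘(ℝ, ℂ) g x)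
    (v : TangentSpace 𝓘(ℝ, EM) x) :
    mvfderiv 𝓘(ℝ, EM) (fun y => f y * g y) x v
      = f x * mvfderiv 𝓘(ℝ, EM) g x v + mvfderiv 𝓘(ℝ, EM) f x v * g x := by
  exact DFunLike.congr_fun (HasMFDerivAt.mul' hf.hasMFDerivAt hg.hasMFDerivAt).mfderiv v

theorem contMDiff_mvfderiv {G : Type*} [NormedAddCommGroup G] [NormedSpace ℝ G]
    [IsManifold 𝓘(ℝ, EM) ∞ M] {f : M → G}
    (hf : ContMDiff 𝓘(ℝ, EM) 𝓘(ℝ, G) ∞ f)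
    (X : Cₛ^∞⟮𝓘(ℝ, EM); EM, (TangentSpace 𝓘(ℝ, EM) : M → Type _)⟯) :
    ContMDiff 𝓘(ℝ, EM) 𝓘(ℝ, G) ∞ fun x => mvfderiv 𝓘(ℝ, EM) f x (X x) := by
  have h := (hf.contMDiff_tangentMap (m := ∞) (by simp)).comp X.contMDiff
  exact (contMDiff_snd_tangentBundle_modelSpace G 𝓘(ℝ, G)).comp h

variable [FiniteDimensional ℝ EM] [T2Space M] [IsManifold 𝓘(ℝ, EM) ∞ M]

/-- Global smooth functions whose derivatives are the coordinates of tangent vectors near a given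
point. -/
theorem exists_coordinates (x₀ : M) : ∃ (N : ℕ) (u : Fin N → M → ℝ) (b : Fin N → EM),
    (∀ i, ContMDiff 𝓘(ℝ, EM) 𝓘(ℝ, ℝ) ∞ (u i)) ∧
      ∀ᶠ x in 𝓝 x₀, ∀ v : TangentSpace 𝓘(ℝ, EM) x,
        mvfderiv 𝓘(ℝ, EM) (extChartAt 𝓘(ℝ, EM) x₀) x v
          = ∑ i, mvfderiv 𝓘(ℝ, EM) (u i) x v • b i := by
  let φ := extChartAt 𝓘(ℝ, EM) x₀
  have hsrc : IsOpen φ.source := isOpen_extChartAt_source x₀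
  have hxs : x₀ ∈ φ.source := mem_extChartAt_source x₀
  have hφ : ContMDiffOn 𝓘(ℝ, EM) 𝓘(ℝ, EM) ∞ φ φ.source := by
    rw [extChartAt_source]
    exact contMDiffOn_extChartAt
  let b := Module.finBasis ℝ EM
  let c : Fin (Module.finrank ℝ EM) → EM →L[ℝ] ℝ := fun i => (b.coord i).toContinuousLinearMap
  have hb : ∀ v, v = ∑ i, c i v • b i := fun v => (b.sum_repr v).symm
  choose u hu hu' using fun i => exists_contMDiff_eventuallyEq hsrc hxs
    ((c i).contDiff.contMDiff.comp_contMDiffOn hφ)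
  refine ⟨_, u, b, hu, ?_⟩
  -- Derivatives are compared at all points near `x₀`, so at each of them the functions must agree
  -- on a neighbourhood.
  filter_upwards [hsrc.mem_nhds hxs, Filter.eventually_all.2 fun i => (hu' i).eventually_nhds]
    with x hx h v
  rw [hb (mvfderiv 𝓘(ℝ, EM) (extChartAt 𝓘(ℝ, EM) x₀) x v)]
  refine Finset.sum_congr rfl fun i _ => ?_
  rw [mvfderiv_congr (h i)]
  have hd : MDifferentiableAt 𝓘(ℝ, EM) 𝓘(ℝ, EM) φ x :=
    ((hφ x hx).contMDiffAt (hsrc.mem_nhds hx)).mdifferentiableAt (by simp)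
  exact congrArg (· • b i) (mvfderiv_clm_comp (c i) hd v).symm

/-- A vector field is smooth if the derivative of every smooth function along it is smooth. -/
theorem contMDiff_of_forall_mvfderiv (v : ∀ x : M, TangentSpace 𝓘(ℝ, EM) x)
    (h : ∀ f : M → ℝ, ContMDiff 𝓘(ℝ, EM) 𝓘(ℝ, ℝ) ∞ f →
      ContMDiff 𝓘(ℝ, EM) 𝓘(ℝ, ℝ) ∞ fun x => mvfderiv 𝓘(ℝ, EM) f x (v x)) :
    ContMDiff 𝓘(ℝ, EM) (𝓘(ℝ, EM).prod 𝓘(ℝ, EM)) ∞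
      (fun x => TotalSpace.mk' EM (E := (TangentSpace 𝓘(ℝ, EM) : M → Type _)) x (v x)) := by
  intro x₀
  obtain ⟨N, u, b, hu, hub⟩ := exists_coordinates (EM := EM) x₀
  rw [contMDiffAt_section]
  -- The trivialization of the tangent bundle at `x₀` is the derivative of the chart, and its
  -- components on `v x` are the derivatives of the functions `u i` along `v`.
  have hs : ContMDiffAt 𝓘(ℝ, EM) 𝓘(ℝ, EM) ∞
      (fun x => ∑ i, mvfderiv 𝓘(ℝ, EM) (u i) x (v x) • b i) x₀ :=
    contMDiffAt_finsetSum fun i _ => (h (u i) (hu i) x₀).smul contMDiffAt_const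
  refine hs.congr_of_eventuallyEq ?_
  filter_upwards [hub, (chartAt EM x₀).open_source.mem_nhds (mem_chart_source EM x₀)] with x hx hx'
  rw [← hx (v x)]
  have h1 := TangentBundle.continuousLinearMapAt_trivializationAt (𝕜 := ℝ) (I := 𝓘(ℝ, EM)) hx'
  have hx2 : x ∈ (trivializationAt EM (TangentSpace 𝓘(ℝ, EM)) x₀).baseSet := by
    rwa [TangentBundle.trivializationAt_baseSet]
  have h2 := DFunLike.congr_fun h1 (v x)
  rw [Trivialization.continuousLinearMapAt_apply_of_mem _ _ hx2] at h2
  exact h2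

/-- Applied to a real coordinate function, the hypothesis splits into its real and imaginary parts,
so all coordinates of `u` and of `w` vanish. This makes images of derivations unique. -/
theorem tangent_eq_zero {x : M} {u w : TangentSpace 𝓘(ℝ, EM) x}
    (h : ∀ f : C^∞⟮𝓘(ℝ, EM), M; 𝓘(ℝ, ℂ), ℂ⟯,
      mvfderiv 𝓘(ℝ, EM) f x u + Complex.I * mvfderiv 𝓘(ℝ, EM) f x w = 0) : u = 0 ∧ w = 0 := by
  obtain ⟨N, c, b, hc, hcb⟩ := exists_coordinates (EM := EM) x
  have hid : ∀ v : TangentSpace 𝓘(ℝ, EM) x,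
      mvfderiv 𝓘(ℝ, EM) (extChartAt 𝓘(ℝ, EM) x) x v = v := fun v =>
    DFunLike.congr_fun (mfderiv_extChartAt_self (I := 𝓘(ℝ, EM)) (x := x)) v
  have hz : ∀ i, mvfderiv 𝓘(ℝ, EM) (c i) x u = 0 ∧ mvfderiv 𝓘(ℝ, EM) (c i) x w = 0 := by
    intro i
    have h1 := h ⟨fun y => (c i y : ℂ), contMDiff_ofReal (hc i)⟩
    have h2 : ∀ v : TangentSpace 𝓘(ℝ, EM) x, mvfderiv 𝓘(ℝ, EM) (fun y => (c i y : ℂ)) x v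
        = (mvfderiv 𝓘(ℝ, EM) (c i) x v : ℝ) := fun v =>
      mvfderiv_clm_comp Complex.ofRealCLM ((hc i).mdifferentiableAt (by simp)) v
    change mvfderiv 𝓘(ℝ, EM) (fun y => (c i y : ℂ)) x u
      + Complex.I * mvfderiv 𝓘(ℝ, EM) (fun y => (c i y : ℂ)) x w = 0 at h1
    rw [h2, h2] at h1
    constructor
    · simpa using congrArg Complex.re h1
    · simpa using congrArg Complex.im h1
  have hcb := hcb.self_of_nhds
  constructor
  · have := hcb u
    rw [hid] at this
    rw [this]
    exact Finset.sum_eq_zero fun i _ => by rw [(hz i).1, zero_smul]; rfl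
  · have := hcb w
    rw [hid] at this
    rw [this]
    exact Finset.sum_eq_zero fun i _ => by rw [(hz i).2, zero_smul]; rfl

/-- The second derivatives of `f` on the right cancel by symmetry; the first-order terms that remain
are the derivative of `f` along the bracket. -/
theorem fderiv_lieBracket {G : Type*} [NormedAddCommGroup G] [NormedSpace ℝ G] {f : EM → G}
    {V W : EM → EM} {z : EM} (hf : ContDiffAt ℝ 2 f z) (hV : DifferentiableAt ℝ V z)
    (hW : DifferentiableAt ℝ W z) :
    fderiv ℝ f z (lieBracket ℝ V W z) = fderiv ℝ (fun y => fderiv ℝ f y (W y)) z (V z)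
      - fderiv ℝ (fun y => fderiv ℝ f y (V y)) z (W z) := by
  have hf2 : DifferentiableAt ℝ (fderiv ℝ f) z :=
    (hf.fderiv_right (m := 1) (by norm_num)).differentiableAt (by simp)
  have hs : IsSymmSndFDerivAt ℝ f z := hf.isSymmSndFDerivAt (by simp)
  rw [lieBracket_eq, fderiv_clm_apply hf2 hV, fderiv_clm_apply hf2 hW]
  simp [hs.eq (V z) (W z)]

/-- Vector fields act on functions by the commutator bracket. -/
theorem mvfderiv_mlieBracket {G : Type*} [NormedAddCommGroup G] [NormedSpace ℝ G] {f : M → G}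
    (hf : ContMDiff 𝓘(ℝ, EM) 𝓘(ℝ, G) ∞ f)
    (X Y : Cₛ^∞⟮𝓘(ℝ, EM); EM, (TangentSpace 𝓘(ℝ, EM) : M → Type _)⟯) (x : M) :
    mvfderiv 𝓘(ℝ, EM) f x (mlieBracket 𝓘(ℝ, EM) X Y x)
      = mvfderiv 𝓘(ℝ, EM) (fun y => mvfderiv 𝓘(ℝ, EM) f y (Y y)) x (X x)
        - mvfderiv 𝓘(ℝ, EM) (fun y => mvfderiv 𝓘(ℝ, EM) f y (X y)) x (Y x) := by
  have : CompleteSpace EM := FiniteDimensional.complete ℝ EM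
  have h2 : (2 : WithTop ℕ∞) ≤ ∞ := (mod_cast le_top : ((2 : ℕ∞) : WithTop ℕ∞) ≤ ∞)
  have : IsManifold 𝓘(ℝ, EM) 2 M := IsManifold.of_le (n := ∞) h2
  set φ := extChartAt 𝓘(ℝ, EM) x with hφ
  have htgt : IsOpen φ.target := isOpen_extChartAt_target x
  have hxt : φ x ∈ φ.target := mem_extChartAt_target x
  have hsymm : ContMDiffOn 𝓘(ℝ, EM) 𝓘(ℝ, EM) ∞ φ.symm φ.target := contMDiffOn_extChartAt_symm x
  let F : EM → G := fun z => f (φ.symm z)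
  have hF : ContDiffOn ℝ ∞ F φ.target :=
    contMDiffOn_iff_contDiffOn.1 (hf.comp_contMDiffOn hsymm)
  have hFx : ContDiffAt ℝ ∞ F (φ x) := hF.contDiffAt (htgt.mem_nhds hxt)
  -- The manifold bracket is defined by pulling both fields back to the model space along the
  -- inverse chart. There the vector space formula applies to the pulled back fields and to `F`.
  let P : (Cₛ^∞⟮𝓘(ℝ, EM); EM, (TangentSpace 𝓘(ℝ, EM) : M → Type _)⟯) → EM → EM := fun Z =>
    mpullbackWithin 𝓘(ℝ, EM) 𝓘(ℝ, EM) φ.symm Z (Set.range 𝓘(ℝ, EM))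
  have hP : ∀ Z, DifferentiableAt ℝ (P Z) (φ x) := by
    intro Z
    have h := MDifferentiableWithinAt.differentiableWithinAt_mpullbackWithin_vectorField
      (s := Set.univ) (x := x) (I := 𝓘(ℝ, EM)) (V := Z)
      (Z.mdifferentiableAt.mdifferentiableWithinAt)
    rw [← differentiableWithinAt_univ]
    convert! h using 1
    simp
  have hfd : ∀ Z, ∀ z ∈ φ.target, fderiv ℝ F z (P Z z)
      = mvfderiv 𝓘(ℝ, EM) f (φ.symm z) (Z (φ.symm z)) := by
    intro Z z hz
    have hA := isInvertible_mfderivWithin_extChartAt_symm (I := 𝓘(ℝ, EM)) hz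
    have hs : MDifferentiableAt 𝓘(ℝ, EM) 𝓘(ℝ, EM) φ.symm z :=
      ((hsymm z hz).contMDiffAt (htgt.mem_nhds hz)).mdifferentiableAt (by simp)
    have hc := (hf.mdifferentiableAt (by simp)).hasMFDerivAt.comp z hs.hasMFDerivAt
    have h1 : fderiv ℝ F z (P Z z) = mvfderiv 𝓘(ℝ, EM) f (φ.symm z)
        (mfderiv 𝓘(ℝ, EM) 𝓘(ℝ, EM) φ.symm z (P Z z)) :=
      (DFunLike.congr_fun mfderiv_eq_fderiv.symm (P Z z)).trans
        (DFunLike.congr_fun hc.mfderiv (P Z z))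
    have h3 : mfderivWithin 𝓘(ℝ, EM) 𝓘(ℝ, EM) φ.symm (Set.range 𝓘(ℝ, EM)) z (P Z z)
        = Z (φ.symm z) := by
      change mfderivWithin 𝓘(ℝ, EM) 𝓘(ℝ, EM) φ.symm (Set.range 𝓘(ℝ, EM)) z
        ((mfderivWithin 𝓘(ℝ, EM) 𝓘(ℝ, EM) φ.symm (Set.range 𝓘(ℝ, EM)) z).inverse _) = _
      exact hA.self_apply_inverse _
    rw [ModelWithCorners.range_eq_univ, mfderivWithin_univ] at h3
    rw [h1, h3]
  -- In the tangent coordinates at `x`, the chart centred at `x` has the identity as derivative at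
  -- `x`, so the inverse occurring in the definition of the bracket disappears.
  have hinv : ∀ v : EM, (mfderiv 𝓘(ℝ, EM) 𝓘(ℝ, EM) φ x).inverse v = v := fun v =>
    DFunLike.congr_fun ((congrArg ContinuousLinearMap.inverse
      (mfderiv_extChartAt_self (I := 𝓘(ℝ, EM)) (x := x))).trans ContinuousLinearMap.inverse_id) v
  have hPx : ∀ Z, P Z (φ x) = Z x := by
    intro Z
    have h1 : ∀ y, y = x → (Z y : EM) = Z x := by
      rintro _ rfl
      rfl
    have h3 := mfderiv_extChartAt_inverse_comp_mfderivWithin_extChartAT_symm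
      (I := 𝓘(ℝ, EM)) (Z x)
    refine Eq.trans ?_ ((hinv _).symm.trans h3)
    exact congrArg (mfderivWithin 𝓘(ℝ, EM) 𝓘(ℝ, EM) φ.symm (Set.range 𝓘(ℝ, EM)) (φ x)).inverse
      (h1 _ (extChartAt_to_inv x))
  have hd : ∀ Z W, mvfderiv 𝓘(ℝ, EM) (fun y => mvfderiv 𝓘(ℝ, EM) f y (W y)) x (Z x)
      = fderiv ℝ (fun z => fderiv ℝ F z (P W z)) (φ x) (P Z (φ x)) := by
    intro Z W
    have hm : MDifferentiableAt 𝓘(ℝ, EM) 𝓘(ℝ, G) (fun y => mvfderiv 𝓘(ℝ, EM) f y (W y)) x :=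
      (contMDiff_mvfderiv hf W).mdifferentiableAt (by simp)
    rw [hm.mvfderiv, ModelWithCorners.range_eq_univ, fderivWithin_univ, hPx]
    have he : writtenInExtChartAt 𝓘(ℝ, EM) 𝓘(ℝ, G) x (fun y => mvfderiv 𝓘(ℝ, EM) f y (W y))
        =ᶠ[𝓝 (φ x)] fun z => fderiv ℝ F z (P W z) := by
      filter_upwards [htgt.mem_nhds hxt] with z hz
      exact (hfd W z hz).symm
    rw [he.fderiv_eq]
    rfl
  have hb : mlieBracket 𝓘(ℝ, EM) X Y x = lieBracket ℝ (P X) (P Y) (φ x) := by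
    rw [← mlieBracketWithin_univ, mlieBracketWithin_apply, ← lieBracketWithin_univ]
    refine (hinv _).trans ?_
    have hu : (extChartAt 𝓘(ℝ, EM) x).symm ⁻¹' Set.univ ∩ Set.range 𝓘(ℝ, EM) = Set.univ := by simp
    rw [hu]
  have hf1 : mvfderiv 𝓘(ℝ, EM) f x = fderiv ℝ F (φ x) := by
    rw [(hf.mdifferentiableAt (by simp)).mvfderiv, ModelWithCorners.range_eq_univ,
      fderivWithin_univ]
    rfl
  rw [hd, hd, hb, hf1]
  have h3 := fderiv_lieBracket (hFx.of_le h2) (hP X) (hP Y)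
  exact h3

theorem contMDiff_I_mul {f : M → ℂ} (hf : ContMDiff 𝓘(ℝ, EM) 𝓘(ℝ, ℂ) ∞ f) :
    ContMDiff 𝓘(ℝ, EM) 𝓘(ℝ, ℂ) ∞ fun x => Complex.I * f x :=
  contMDiff_mul contMDiff_const hf

namespace CVectorField

theorem ext' {X Y : CVectorField EM M} (h : ∀ x, X.re x = Y.re x) (h' : ∀ x, X.im x = Y.im x) :
    X = Y := by
  cases X
  cases Y
  congr 1
  · exact ContMDiffSection.ext h
  · exact ContMDiffSection.ext h'

theorem contMDiff_deriv (X : CVectorField EM M) {f : M → ℂ}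
    (hf : ContMDiff 𝓘(ℝ, EM) 𝓘(ℝ, ℂ) ∞ f) : ContMDiff 𝓘(ℝ, EM) 𝓘(ℝ, ℂ) ∞ (X.deriv f) :=
  (contMDiff_mvfderiv hf X.re).add (contMDiff_I_mul (contMDiff_mvfderiv hf X.im))

theorem deriv_mul (X : CVectorField EM M) {f g : M → ℂ} {x : M}
    (hf : MDifferentiableAt 𝓘(ℝ, EM) 𝓘(ℝ, ℂ) f x) (hg : MDifferentiableAt 𝓘(ℝ, EM) 𝓘(ℝ, ℂ) g x) :
    X.deriv (fun y => f y * g y) x = f x * X.deriv g x + X.deriv f x * g x := by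
  simp only [deriv, mvfderiv_complex_mul hf hg]
  ring

theorem deriv_congr (X : CVectorField EM M) {f g : M → ℂ} {x : M} (h : f =ᶠ[𝓝 x] g) :
    X.deriv f x = X.deriv g x := by
  simp only [deriv, mvfderiv_congr h]

theorem deriv_const (X : CVectorField EM M) (c : ℂ) (x : M) : X.deriv (fun _ => c) x = 0 := by
  simp [deriv, mvfderiv_const]

theorem deriv_bracket (X Y : CVectorField EM M) {f : M → ℂ}
    (hf : ContMDiff 𝓘(ℝ, EM) 𝓘(ℝ, ℂ) ∞ f) (x : M) :
    (X.bracket Y).deriv f x = X.deriv (Y.deriv f) x - Y.deriv (X.deriv f) x := by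
  have h1 : ∀ (Z : CVectorField EM M) (v : TangentSpace 𝓘(ℝ, EM) x),
      mvfderiv 𝓘(ℝ, EM) (Z.deriv f) x v
        = mvfderiv 𝓘(ℝ, EM) (fun y => mvfderiv 𝓘(ℝ, EM) f y (Z.re y)) x v
          + Complex.I * mvfderiv 𝓘(ℝ, EM) (fun y => mvfderiv 𝓘(ℝ, EM) f y (Z.im y)) x v := by
    intro Z v
    have hr := (contMDiff_mvfderiv hf Z.re).mdifferentiableAt (by simp) (x := x)
    have hi := (contMDiff_mvfderiv hf Z.im).mdifferentiableAt (by simp) (x := x)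
    have hi' := (contMDiff_I_mul (contMDiff_mvfderiv hf Z.im)).mdifferentiableAt (by simp) (x := x)
    have hc := mvfderiv_clm_comp (ContinuousLinearMap.mul ℝ ℂ Complex.I) hi v
    have ha := DFunLike.congr_fun (mvfderiv_add hr hi') v
    exact ha.trans (congrArg (mvfderiv 𝓘(ℝ, EM) (fun y => mvfderiv 𝓘(ℝ, EM) f y (Z.re y)) x v + ·) hc)
  have e1 : ((X.bracket Y).re x) = mlieBracket 𝓘(ℝ, EM) X.re Y.re x
      - mlieBracket 𝓘(ℝ, EM) X.im Y.im x := rfl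
  have e2 : ((X.bracket Y).im x) = mlieBracket 𝓘(ℝ, EM) X.re Y.im x
      + mlieBracket 𝓘(ℝ, EM) X.im Y.re x := rfl
  change mvfderiv 𝓘(ℝ, EM) f x ((X.bracket Y).re x)
      + Complex.I * mvfderiv 𝓘(ℝ, EM) f x ((X.bracket Y).im x)
    = mvfderiv 𝓘(ℝ, EM) (Y.deriv f) x (X.re x) + Complex.I * mvfderiv 𝓘(ℝ, EM) (Y.deriv f) x (X.im x)
      - (mvfderiv 𝓘(ℝ, EM) (X.deriv f) x (Y.re x)
        + Complex.I * mvfderiv 𝓘(ℝ, EM) (X.deriv f) x (Y.im x))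
  rw [e1, e2, map_sub, map_add, h1, h1, h1, h1]
  simp only [mvfderiv_mlieBracket hf]
  -- The contribution of the two imaginary parts carries the factor `I ^ 2`, which is the minus sign
  -- in the real part of the complex bracket.
  linear_combination (-(mvfderiv 𝓘(ℝ, EM) (fun y => mvfderiv 𝓘(ℝ, EM) f y (Y.im y)) x (X.im x)
    - mvfderiv 𝓘(ℝ, EM) (fun y => mvfderiv 𝓘(ℝ, EM) f y (X.im y)) x (Y.im x))) * Complex.I_sq

end CVectorField

/-- A derivation of the algebra of smooth complex functions is a complex vector field. -/
theorem exists_cVectorField {δ : C^∞⟮𝓘(ℝ, EM), M; 𝓘(ℝ, ℂ), ℂ⟯ → M → ℂ}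
    (hδ : ∀ x, IsPointDerivation x (fun f => δ f x))
    (hs : ∀ f, ContMDiff 𝓘(ℝ, EM) 𝓘(ℝ, ℂ) ∞ (δ f)) :
    ∃ X : CVectorField EM M, ∀ f x, δ f x = X.deriv f x := by
  choose u w huw using fun x => (hδ x).exists_eq_mvfderiv
  -- On a real function, the derivatives along `u` and `w` are the real and imaginary parts of the
  -- smooth function `δ f`. Hence both pointwise chosen fields are smooth.
  have hr : ∀ f : M → ℝ, ∀ hf : ContMDiff 𝓘(ℝ, EM) 𝓘(ℝ, ℝ) ∞ f, ∀ x,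
      δ ⟨fun y => (f y : ℂ), contMDiff_ofReal hf⟩ x
        = (mvfderiv 𝓘(ℝ, EM) f x (u x) : ℝ) + Complex.I * (mvfderiv 𝓘(ℝ, EM) f x (w x) : ℝ) := by
    intro f hf x
    have h2 : ∀ v : TangentSpace 𝓘(ℝ, EM) x, mvfderiv 𝓘(ℝ, EM) (fun y => (f y : ℂ)) x v
        = (mvfderiv 𝓘(ℝ, EM) f x v : ℝ) := fun v =>
      mvfderiv_clm_comp Complex.ofRealCLM (hf.mdifferentiableAt (by simp)) v
    rw [← h2, ← h2]
    exact huw x _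
  refine ⟨⟨⟨u, contMDiff_of_forall_mvfderiv u fun f hf => ?_⟩,
    ⟨w, contMDiff_of_forall_mvfderiv w fun f hf => ?_⟩⟩, fun f x => huw x f⟩
  · refine (Complex.reCLM.contDiff.comp_contMDiff
      (hs ⟨fun y => (f y : ℂ), contMDiff_ofReal hf⟩)).congr fun x => ?_
    simp [hr f hf]
  · refine (Complex.imCLM.contDiff.comp_contMDiff
      (hs ⟨fun y => (f y : ℂ), contMDiff_ofReal hf⟩)).congr fun x => ?_
    simp [hr f hf]

end VectorFields

end SUBundle

/-! ### Local frames and endomorphism fields -/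

noncomputable section

namespace SUBundle

open DerCalc
open scoped Topology

section Frames

variable {EM : Type*} [NormedAddCommGroup EM] [NormedSpace ℝ EM]
  {M : Type*} [TopologicalSpace M] [ChartedSpace EM M]
  {F : Type*} [NormedAddCommGroup F] [NormedSpace ℂ F]
  {V : M → Type*} [∀ x, AddCommGroup (V x)] [∀ x, Module ℂ (V x)]
  [TopologicalSpace (TotalSpace F V)] [∀ x, TopologicalSpace (V x)]
  [∀ x, IsTopologicalAddGroup (V x)] [∀ x, ContinuousSMul ℂ (V x)]
  [FiberBundle F V] [VectorBundle ℂ F V] [VectorBundle ℝ F V]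
  [ContMDiffVectorBundle ∞ F V 𝓘(ℝ, EM)]

/-- The action of `Γ(End(E))` on `Γ(E)`. -/
def actSec (S : EndAlg EM F V) (s : Sec EM F V) : Sec EM F V :=
  ⟨act S s, ContMDiff.clm_bundle_apply (ϕ := fun x => (S.1 x).restrictScalars ℝ) S.2 s.contMDiff⟩

theorem actSec_apply (S : EndAlg EM F V) (s : Sec EM F V) (x : M) :
    actSec S s x = S.1 x (s x) := rfl

/-- The product of a smooth complex function and a smooth section. -/
def smulSec (f : C^∞⟮𝓘(ℝ, EM), M; 𝓘(ℝ, ℂ), ℂ⟯) (s : Sec EM F V) : Sec EM F V :=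
  actSec (scalar f) s

theorem smulSec_apply (f : C^∞⟮𝓘(ℝ, EM), M; 𝓘(ℝ, ℂ), ℂ⟯) (s : Sec EM F V) (x : M) :
    smulSec f s x = f x • s x := rfl

variable (F V) in
/-- A local frame near `x₀`, given by globally defined smooth sections and coordinate forms. -/
structure LocalFrame (x₀ : M) (n : ℕ) where
  e : Fin n → Sec EM F V
  φ : Fin n → ∀ x, V x →L[ℂ] ℂ
  contMDiff_φ : ∀ i (s : Sec EM F V), ContMDiff 𝓘(ℝ, EM) 𝓘(ℝ, ℂ) ∞ fun x => φ i x (s x)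
  dual : ∀ᶠ x in 𝓝 x₀, (∀ i j, φ i x (e j x) = if i = j then 1 else 0) ∧
    ∀ v, ∑ i, φ i x v • e i x = v

variable [FiniteDimensional ℝ EM] [T2Space M] [IsManifold 𝓘(ℝ, EM) ∞ M] [FiniteDimensional ℂ F]

/-- The constant sections in a local trivialization extend to smooth sections. -/
theorem exists_sec_eventuallyEq_symm (x₀ : M) (v : F) : ∃ s : Sec EM F V,
    ∀ᶠ x in 𝓝 x₀, s x = (trivializationAt F V x₀).symm x v := by
  let t := trivializationAt F V x₀
  have ht : t.baseSet ∈ 𝓝 x₀ :=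
    t.open_baseSet.mem_nhds (FiberBundle.mem_baseSet_trivializationAt F V x₀)
  obtain ⟨ψ, hψ, h1, hs⟩ := exists_contMDiff_bump (EM := EM) ht
  have hsec : ContMDiffOn 𝓘(ℝ, EM) (𝓘(ℝ, EM).prod 𝓘(ℝ, F)) ∞
      (fun x => TotalSpace.mk' F (E := V) x (t.symm x v)) t.baseSet := by
    rw [t.contMDiffOn_section_baseSet_iff]
    refine (contMDiffOn_const (c := v)).congr fun y hy => ?_
    rw [t.apply_mk_symm hy]
  refine ⟨⟨ψ • fun x => t.symm x v, ContMDiffOn.smul_section_of_tsupport hψ.contMDiffOn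
      t.open_baseSet hs hsec⟩, ?_⟩
  filter_upwards [h1] with x hx
  change ψ x • t.symm x v = _
  rw [hx, one_smul]

/-- A frame and its dual coframe in a local trivialization are cut off by bump functions. They
become globally smooth, so that derivations and connections can be applied to them, and remain dual
only near `x₀`. -/
theorem exists_localFrame (x₀ : M) {n : ℕ} (hn : Module.finrank ℂ F = n) :
    Nonempty (LocalFrame (EM := EM) F V x₀ n) := by
  let t := trivializationAt F V x₀
  let b : Module.Basis (Fin n) ℂ F := Module.finBasisOfFinrankEq ℂ F hn
  have ht : t.baseSet ∈ 𝓝 x₀ :=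
    t.open_baseSet.mem_nhds (FiberBundle.mem_baseSet_trivializationAt F V x₀)
  obtain ⟨ψ, hψ, h1, hs⟩ := exists_contMDiff_bump (EM := EM) ht
  have hsec : ∀ i, ∃ s : Sec EM F V, ∀ᶠ x in 𝓝 x₀, s x = t.symm x (b i) := fun i =>
    exists_sec_eventuallyEq_symm x₀ (b i)
  choose e he using hsec
  let c : Fin n → F →L[ℂ] ℂ := fun i => (b.coord i).toContinuousLinearMap
  let φ : Fin n → ∀ x, V x →L[ℂ] ℂ := fun i x =>
    ((ψ x : ℝ) : ℂ) • (c i).comp (t.continuousLinearMapAt ℂ x)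
  refine ⟨⟨e, φ, fun i s => ?_, ?_⟩⟩
  · have h2 : ContMDiffOn 𝓘(ℝ, EM) 𝓘(ℝ, ℂ) ∞ (fun x => c i (t ⟨x, s x⟩).2) t.baseSet :=
      ((c i).restrictScalars ℝ).contDiff.contMDiff.comp_contMDiffOn
        (t.contMDiffOn_section_baseSet_iff.1 s.contMDiff.contMDiffOn)
    refine (contMDiff_smul_of_tsupport hψ t.open_baseSet hs h2).congr fun x => ?_
    by_cases hx : x ∈ t.baseSet
    · simp [φ, t.continuousLinearMapAt_apply_of_mem ℂ hx]
    · have h0 : ψ x = 0 := image_eq_zero_of_notMem_tsupport fun h => hx (hs h)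
      simp [φ, h0]
  · filter_upwards [h1, ht, Filter.eventually_all.2 he] with x hx hxt he
    constructor
    · intro i j
      rw [he]
      simp [φ, hx, t.continuousLinearMapAt_apply_of_mem ℂ hxt, t.apply_mk_symm hxt, c,
        Finsupp.single_apply, eq_comm]
    · intro v
      have h3 : ∀ w : F, ∑ i, c i w • b i = w := fun w => b.sum_repr w
      have h4 := congrArg (t.symmL ℂ x) (h3 (t.continuousLinearMapAt ℂ x v))
      rw [t.symmL_continuousLinearMapAt hxt, map_sum] at h4
      refine Eq.trans (Finset.sum_congr rfl fun i _ => ?_) h4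
      rw [he, map_smul, t.symmL_apply hxt]
      simp [φ, hx]

namespace LocalFrame

variable {n : ℕ} {x₀ : M} (l : LocalFrame (EM := EM) F V x₀ n)

/-- The coordinates of a section in a local frame. -/
def coord (i : Fin n) (s : Sec EM F V) : C^∞⟮𝓘(ℝ, EM), M; 𝓘(ℝ, ℂ), ℂ⟯ :=
  ⟨fun x => l.φ i x (s x), l.contMDiff_φ i s⟩

/-- The condition that the local frame is a frame at the given point. -/
def IsFrameAt (x : M) : Prop :=
  (∀ i j, l.φ i x (l.e j x) = if i = j then 1 else 0) ∧ ∀ v, ∑ i, l.φ i x v • l.e i x = v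

variable {l}

/-- The basis of the fibre given by a local frame. -/
def IsFrameAt.basis {x : M} (h : l.IsFrameAt x) : Module.Basis (Fin n) ℂ (V x) :=
  Module.Basis.ofEquivFun
    { toFun := fun v i => l.φ i x v
      map_add' := fun v w => funext fun i => map_add _ _ _
      map_smul' := fun c v => funext fun i => map_smul _ _ _
      invFun := fun c => ∑ i, c i • l.e i x
      left_inv := fun v => h.2 v
      right_inv := fun c => funext fun i => by simp [map_sum, h.1] }

theorem IsFrameAt.basis_apply {x : M} (h : l.IsFrameAt x) (i : Fin n) : h.basis i = l.e i x := by
  classical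
  simp [basis, Module.Basis.coe_ofEquivFun, Pi.single_apply]

theorem IsFrameAt.repr_apply {x : M} (h : l.IsFrameAt x) (v : V x) (i : Fin n) :
    h.basis.repr v i = l.φ i x v := rfl

theorem IsFrameAt.trace_eq {x : M} (h : l.IsFrameAt x) (T : V x →L[ℂ] V x) :
    LinearMap.trace ℂ (V x) T.toLinearMap = ∑ i, l.φ i x (T (l.e i x)) := by
  classical
  rw [LinearMap.trace_eq_matrix_trace ℂ h.basis, Matrix.trace]
  refine Finset.sum_congr rfl fun i _ => ?_
  rw [Matrix.diag_apply, LinearMap.toMatrix_apply, h.repr_apply, h.basis_apply]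
  rfl

/-- A continuous linear map commuting with all the matrix units of a frame is a scalar. -/
theorem IsFrameAt.eq_smul_one {x : M} (h : l.IsFrameAt x) (T : V x →L[ℂ] V x) (i₀ : Fin n)
    (hT : ∀ i v, T (l.φ i₀ x v • l.e i x) = l.φ i₀ x (T v) • l.e i x) :
    T = l.φ i₀ x (T (l.e i₀ x)) • 1 := by
  -- Commutation with the matrix unit taking `e i₀` to `e i`, evaluated at `e i₀`.
  have h1 : ∀ i, T (l.e i x) = l.φ i₀ x (T (l.e i₀ x)) • l.e i x := by
    intro i
    rw [← hT, h.1, if_pos rfl, one_smul]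
  ext v
  have h2 := congrArg T (h.2 v)
  rw [map_sum] at h2
  rw [← h2]
  refine Eq.trans ?_ (congrArg (l.φ i₀ x (T (l.e i₀ x)) • ·) (h.2 v))
  simp only [Finset.smul_sum]
  refine Finset.sum_congr rfl fun i _ => ?_
  rw [map_smul, h1, smul_comm]

variable (l) in
theorem eventually_isFrameAt : ∀ᶠ x in 𝓝 x₀, l.IsFrameAt x := l.dual

variable (l) in
theorem isFrameAt_self : l.IsFrameAt x₀ := l.dual.self_of_nhds

end LocalFrame

theorem sum_sec_apply {ι : Type*} (s : Finset ι) (t : ι → Sec EM F V) (x : M) :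
    (∑ i ∈ s, t i) x = ∑ i ∈ s, t i x := by
  have h := congrFun (map_sum (ContMDiffSection.coeAddHom 𝓘(ℝ, EM) F ∞ V) t s) x
  rw [Finset.sum_apply] at h
  exact h

/-- Every vector of a fibre extends to a smooth section. -/
theorem exists_sec_apply_eq (x : M) (v : V x) : ∃ s : Sec EM F V, s x = v := by
  obtain ⟨l⟩ := exists_localFrame (EM := EM) (F := F) (V := V) x rfl
  refine ⟨∑ i, smulSec ⟨fun _ => l.φ i x v, contMDiff_const⟩ (l.e i), ?_⟩
  rw [sum_sec_apply]
  exact l.isFrameAt_self.2 v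

/-- A family of endomorphisms which maps smooth sections to smooth sections is smooth. -/
theorem isSmoothEnd_of_forall_sec {S : ∀ x, V x →L[ℂ] V x}
    (hS : ∀ s : Sec EM F V, ContMDiff 𝓘(ℝ, EM) (𝓘(ℝ, EM).prod 𝓘(ℝ, F)) ∞
      fun x => TotalSpace.mk' F (E := V) x (S x (s x))) : IsSmoothEnd EM F V S := by
  rw [isSmoothEnd_iff]
  intro x₀
  let t := trivializationAt F V x₀
  have ht : t.baseSet ∈ 𝓝 x₀ :=
    t.open_baseSet.mem_nhds (FiberBundle.mem_baseSet_trivializationAt F V x₀)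
  have : FiniteDimensional ℝ F := FiniteDimensional.complexToReal F
  -- A real basis, since smoothness refers to the bundle of real endomorphisms. A real linear map
  -- `g` is the sum of the rank one maps built from `c i` and `g (b i)`.
  let b := Module.finBasis ℝ F
  let c : Fin (Module.finrank ℝ F) → F →L[ℝ] ℝ := fun i => (b.coord i).toContinuousLinearMap
  choose s hs using fun i => exists_sec_eventuallyEq_symm (EM := EM) (V := V) x₀ (b i)
  have hsm : ContMDiffAt 𝓘(ℝ, EM) 𝓘(ℝ, F →L[ℝ] F) ∞
      (fun x => ∑ i, ContinuousLinearMap.smulRightL ℝ F F (c i) (t ⟨x, S x (s i x)⟩).2) x₀ := by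
    refine contMDiffAt_finsetSum fun i _ => ?_
    exact (ContinuousLinearMap.contMDiff _).contMDiffAt.comp x₀
      ((contMDiffAt_section x₀).1 (hS (s i) x₀))
  refine hsm.congr_of_eventuallyEq ?_
  filter_upwards [ht, Filter.eventually_all.2 hs] with x hx hsx
  rw [ContinuousLinearMap.inCoordinates_eq hx hx]
  have h1 : ∀ g : F →L[ℝ] F,
      g = ∑ i, ContinuousLinearMap.smulRightL ℝ F F (c i) (g (b i)) := by
    intro g
    ext v
    have h2 := congrArg g (b.sum_repr v)
    rw [map_sum] at h2
    rw [sum_apply, ← h2]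
    exact Finset.sum_congr rfl fun i _ => map_smul _ _ _
  rw [h1 (ContinuousLinearMap.comp _ _)]
  refine Finset.sum_congr rfl fun i _ => ?_
  rw [hsx]
  rfl

/-- The rank one endomorphism given by a smooth linear form and a smooth section. -/
def rankOne (ξ : ∀ x, V x →L[ℂ] ℂ)
    (hξ : ∀ s : Sec EM F V, ContMDiff 𝓘(ℝ, EM) 𝓘(ℝ, ℂ) ∞ fun x => ξ x (s x)) (s : Sec EM F V) :
    EndAlg EM F V :=
  ⟨fun x => (ξ x).smulRight (s x), isSmoothEnd_of_forall_sec fun t =>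
    (smulSec ⟨_, hξ t⟩ s).contMDiff⟩

/-- The matrix units of a local frame. -/
def LocalFrame.unit {n : ℕ} {x₀ : M} (l : LocalFrame (EM := EM) F V x₀ n) (i j : Fin n) :
    EndAlg EM F V :=
  rankOne (l.φ j) (l.contMDiff_φ j) (l.e i)

/-- Smoothness is a local property. -/
theorem isSmoothEnd_of_locally {S : ∀ x, V x →L[ℂ] V x}
    (hS : ∀ x₀, ∃ T : EndAlg EM F V, ∀ᶠ x in 𝓝 x₀, S x = T.1 x) : IsSmoothEnd EM F V S := by
  intro x₀
  obtain ⟨T, hT⟩ := hS x₀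
  refine (T.2 x₀).congr_of_eventuallyEq ?_
  filter_upwards [hT] with x hx
  rw [hx]

/-- The trace of an endomorphism field. -/
def traceFun (S : EndAlg EM F V) : C^∞⟮𝓘(ℝ, EM), M; 𝓘(ℝ, ℂ), ℂ⟯ :=
  ⟨fun x => LinearMap.trace ℂ (V x) (S.1 x).toLinearMap, by
    intro x₀
    obtain ⟨l⟩ := exists_localFrame (EM := EM) (F := F) (V := V) x₀ rfl
    have h : ContMDiff 𝓘(ℝ, EM) 𝓘(ℝ, ℂ) ∞ fun x => ∑ i, l.φ i x (S.1 x (l.e i x)) :=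
      contMDiff_finsetSum fun i _ => l.contMDiff_φ i (actSec S (l.e i))
    refine (h x₀).congr_of_eventuallyEq ?_
    filter_upwards [l.eventually_isFrameAt] with x hx
    exact hx.trace_eq _⟩

theorem traceFun_apply (S : EndAlg EM F V) (x : M) :
    traceFun S x = LinearMap.trace ℂ (V x) (S.1 x).toLinearMap := rfl

/-- An endomorphism of a fibre commuting with the values of all smooth endomorphism fields is a
scalar. -/
theorem exists_eq_smul_one (hF : 0 < Module.finrank ℂ F) {x : M} (T : V x →L[ℂ] V x)
    (hT : ∀ S : EndAlg EM F V, T * S.1 x = S.1 x * T) : ∃ c : ℂ, T = c • 1 := by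
  obtain ⟨l⟩ := exists_localFrame (EM := EM) (F := F) (V := V) x rfl
  exact ⟨_, l.isFrameAt_self.eq_smul_one T ⟨0, hF⟩ fun i v =>
    DFunLike.congr_fun (hT (l.unit i ⟨0, hF⟩)) v⟩

theorem finrank_fibre (x : M) : Module.finrank ℂ (V x) = Module.finrank ℂ F :=
  ((trivializationAt F V x).linearEquivAt ℂ x
    (FiberBundle.mem_baseSet_trivializationAt F V x)).finrank_eq

variable (F) in
theorem trace_smul_one (c : ℂ) (x : M) :
    LinearMap.trace ℂ (V x) (c • (1 : V x →L[ℂ] V x)).toLinearMap = Module.finrank ℂ F * c := by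
  have : Module.Finite ℂ (V x) := Module.Finite.equiv ((trivializationAt F V x).linearEquivAt ℂ x
    (FiberBundle.mem_baseSet_trivializationAt F V x)).symm
  change LinearMap.trace ℂ (V x) (c • (1 : V x →ₗ[ℂ] V x)) = _
  rw [map_smul, LinearMap.trace_one, finrank_fibre (F := F), smul_eq_mul, mul_comm]

/-- A traceless endomorphism of a fibre commuting with the values of all smooth endomorphism
fields vanishes. -/
theorem eq_zero_of_commute_of_trace (hF : 0 < Module.finrank ℂ F) {x : M} (T : V x →L[ℂ] V x)
    (hT : ∀ S : EndAlg EM F V, T * S.1 x = S.1 x * T)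
    (ht : LinearMap.trace ℂ (V x) T.toLinearMap = 0) : T = 0 := by
  obtain ⟨c, rfl⟩ := exists_eq_smul_one hF T hT
  rw [trace_smul_one F] at ht
  have : (Module.finrank ℂ F : ℂ) ≠ 0 := by exact_mod_cast hF.ne'
  rw [(mul_eq_zero.1 ht).resolve_left this, zero_smul]

theorem trace_mul_comm' (x : M) (S T : V x →L[ℂ] V x) :
    LinearMap.trace ℂ (V x) (S * T - T * S).toLinearMap = 0 := by
  change LinearMap.trace ℂ (V x) (S.toLinearMap * T.toLinearMap - T.toLinearMap * S.toLinearMap) = 0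
  rw [map_sub, LinearMap.trace_mul_comm, sub_self]

/-- An additive operator on sections which commutes with multiplication by functions is given by
an endomorphism field. -/
theorem exists_actSec_eq (Q : Sec EM F V → Sec EM F V) (hadd : ∀ s t, Q (s + t) = Q s + Q t)
    (hsmul : ∀ f s, Q (smulSec f s) = smulSec f (Q s)) : ∃ S : EndAlg EM F V, ∀ s, Q s = actSec S s := by
  let l := fun x => (exists_localFrame (EM := EM) (F := F) (V := V) x rfl).some
  have hsum : ∀ {ι : Type} (a : Finset ι) (t : ι → Sec EM F V),
      Q (∑ i ∈ a, t i) = ∑ i ∈ a, Q (t i) := fun a t => map_sum (AddMonoidHom.mk' Q hadd) t a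
  have hloc : ∀ (s t : Sec EM F V) (x : M), (∀ᶠ y in 𝓝 x, s y = t y) → Q s x = Q t x := by
    intro s t x hst
    obtain ⟨ψ, hψ, h1, hs⟩ := exists_contMDiff_bump (EM := EM) hst
    let p : C^∞⟮𝓘(ℝ, EM), M; 𝓘(ℝ, ℂ), ℂ⟯ := ⟨fun y => (ψ y : ℂ), contMDiff_ofReal hψ⟩
    have hp : p x = 1 := by
      change ((ψ x : ℝ) : ℂ) = 1
      rw [h1.self_of_nhds, Complex.ofReal_one]
    have he : smulSec p s = smulSec p t := by
      ext y
      rw [smulSec_apply, smulSec_apply]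
      by_cases hy : y ∈ tsupport ψ
      · have h2 : s y = t y := hs hy
        rw [h2]
      · have h2 : p y = 0 := by
          change ((ψ y : ℝ) : ℂ) = 0
          rw [image_eq_zero_of_notMem_tsupport hy, Complex.ofReal_zero]
        rw [h2, zero_smul, zero_smul]
    have h3 := DFunLike.congr_fun (congrArg Q he) x
    rw [hsmul, hsmul, smulSec_apply, smulSec_apply, hp, one_smul, one_smul] at h3
    exact h3
  -- Each point uses its own frame and the choices need not vary smoothly. Smoothness follows
  -- afterwards, because `S x (s x) = Q s x` shows that `S` maps smooth sections to smooth sections.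
  let S : ∀ x, V x →L[ℂ] V x := fun x =>
    ∑ i, ((l x).φ i x).smulRight (Q ((l x).e i) x)
  have hS : ∀ (s : Sec EM F V) (x : M), S x (s x) = Q s x := by
    intro s x
    have h1 : ∀ᶠ y in 𝓝 x, s y
        = (∑ i, smulSec ((l x).coord i s) ((l x).e i) : Sec EM F V) y := by
      filter_upwards [(l x).eventually_isFrameAt] with y hy
      rw [sum_sec_apply]
      exact (hy.2 (s y)).symm
    rw [hloc _ _ x h1, hsum, sum_sec_apply]
    simp only [S, sum_apply]
    refine Finset.sum_congr rfl fun i _ => ?_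
    have h2 := DFunLike.congr_fun (hsmul ((l x).coord i s) ((l x).e i)) x
    rw [smulSec_apply] at h2
    exact h2.symm
  refine ⟨⟨S, isSmoothEnd_of_forall_sec fun s => ?_⟩, fun s => ContMDiffSection.ext fun x =>
    (hS s x).symm⟩
  simp only [hS]
  exact (Q s).contMDiff

end Frames

end SUBundle
end

/-! ### Derivations of the endomorphism algebra: images and inner derivations -/

noncomputable section

namespace SUBundle

open DerCalc
open scoped Topology

section Derivations

variable {EM : Type*} [NormedAddCommGroup EM] [NormedSpace ℝ EM]
  {M : Type*} [TopologicalSpace M] [ChartedSpace EM M]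
  {F : Type*} [NormedAddCommGroup F] [NormedSpace ℂ F]
  {V : M → Type*} [∀ x, AddCommGroup (V x)] [∀ x, Module ℂ (V x)]
  [TopologicalSpace (TotalSpace F V)] [∀ x, TopologicalSpace (V x)]
  [∀ x, IsTopologicalAddGroup (V x)] [∀ x, ContinuousSMul ℂ (V x)]
  [FiberBundle F V] [VectorBundle ℂ F V] [VectorBundle ℝ F V]
  [ContMDiffVectorBundle ∞ F V 𝓘(ℝ, EM)]

theorem EndAlg.ext {S T : EndAlg EM F V} (h : ∀ x, S.1 x = T.1 x) : S = T :=
  Subtype.ext (funext h)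

theorem EndAlg.sum_apply {ι : Type*} (a : Finset ι) (S : ι → EndAlg EM F V) (x : M) :
    (∑ i ∈ a, S i).1 x = ∑ i ∈ a, (S i).1 x := by
  have h := map_sum (((Pi.evalAlgHom ℂ (fun x => V x →L[ℂ] V x) x).comp
    (EndAlg EM F V).val).toLinearMap) S a
  exact h

theorem scalar_mul_comm (f : C^∞⟮𝓘(ℝ, EM), M; 𝓘(ℝ, ℂ), ℂ⟯) (S : EndAlg EM F V) :
    scalar f * S = S * scalar f := by
  refine EndAlg.ext fun x => ContinuousLinearMap.ext fun v => ?_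
  exact (map_smul (S.1 x) (f x) v).symm

theorem scalar_mem_center (f : C^∞⟮𝓘(ℝ, EM), M; 𝓘(ℝ, ℂ), ℂ⟯) :
    scalar f ∈ Z ℂ (EndAlg EM F V) :=
  Subalgebra.mem_center_iff.2 fun S => (scalar_mul_comm f S).symm

theorem der_zero (D : Der ℂ (EndAlg EM F V)) : D.1 0 = 0 := LinearMap.map_zero D.1

theorem der_add (D : Der ℂ (EndAlg EM F V)) (S T : EndAlg EM F V) :
    D.1 (S + T) = D.1 S + D.1 T := LinearMap.map_add D.1 S T

theorem der_sub (D : Der ℂ (EndAlg EM F V)) (S T : EndAlg EM F V) :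
    D.1 (S - T) = D.1 S - D.1 T := LinearMap.map_sub D.1 S T

theorem der_smul (D : Der ℂ (EndAlg EM F V)) (c : ℂ) (S : EndAlg EM F V) :
    D.1 (c • S) = c • D.1 S := LinearMap.map_smul D.1 c S

theorem der_sum (D : Der ℂ (EndAlg EM F V)) {ι : Type*} (a : Finset ι) (S : ι → EndAlg EM F V) :
    D.1 (∑ i ∈ a, S i) = ∑ i ∈ a, D.1 (S i) := map_sum D.1 S a

theorem der_one (D : Der ℂ (EndAlg EM F V)) : D.1 1 = 0 := by
  have h := Der.leibniz D 1 1
  rw [one_mul, mul_one, one_mul] at h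
  exact left_eq_add.1 h

variable [FiniteDimensional ℝ EM] [T2Space M] [IsManifold 𝓘(ℝ, EM) ∞ M] [FiniteDimensional ℂ F]

/-- Derivations are local operators. -/
theorem der_congr (D : Der ℂ (EndAlg EM F V)) {S T : EndAlg EM F V} {x : M}
    (h : ∀ᶠ y in 𝓝 x, S.1 y = T.1 y) : (D.1 S).1 x = (D.1 T).1 x := by
  obtain ⟨ψ, hψ, h1, hs⟩ := exists_contMDiff_bump (EM := EM) h
  let p : C^∞⟮𝓘(ℝ, EM), M; 𝓘(ℝ, ℂ), ℂ⟯ := ⟨fun y => (ψ y : ℂ), contMDiff_ofReal hψ⟩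
  have hp : p x = 1 := by
    change ((ψ x : ℝ) : ℂ) = 1
    rw [h1.self_of_nhds, Complex.ofReal_one]
  -- In the Leibniz expansion of `D` on this product, the term containing `D (scalar p)` vanishes at
  -- `x` because `S` and `T` agree there.
  have he : scalar p * (S - T) = 0 := by
    refine EndAlg.ext fun y => ?_
    change (p y • (1 : V y →L[ℂ] V y)) * (S.1 y - T.1 y) = 0
    by_cases hy : y ∈ tsupport ψ
    · have h2 : S.1 y = T.1 y := hs hy
      rw [h2, sub_self, mul_zero]
    · have h2 : p y = 0 := by
        change ((ψ y : ℝ) : ℂ) = 0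
        rw [image_eq_zero_of_notMem_tsupport hy, Complex.ofReal_zero]
      rw [h2, zero_smul, zero_mul]
  have h3 := congrArg D.1 he
  rw [Der.leibniz D, der_zero, der_sub] at h3
  have h4 : (D.1 (scalar p)).1 x * (S.1 x - T.1 x)
      + (p x • (1 : V x →L[ℂ] V x)) * ((D.1 S).1 x - (D.1 T).1 x) = 0 :=
    congrFun (congrArg Subtype.val h3) x
  have h5 : S.1 x = T.1 x := h.self_of_nhds
  rw [h5, sub_self, mul_zero, zero_add, hp, one_smul, one_mul] at h4
  exact sub_eq_zero.1 h4

variable (F) in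
theorem smul_one_injective (hF : 0 < Module.finrank ℂ F) (x : M) {c d : ℂ}
    (h : c • (1 : V x →L[ℂ] V x) = d • 1) : c = d := by
  have h1 := congrArg (fun T : V x →L[ℂ] V x => LinearMap.trace ℂ (V x) T.toLinearMap) h
  simp only [trace_smul_one F] at h1
  have : (Module.finrank ℂ F : ℂ) ≠ 0 := by exact_mod_cast hF.ne'
  exact mul_left_cancel₀ this h1

/-- The traceless part. -/
def tracelessPart (S : EndAlg EM F V) : EndAlg EM F V :=
  S - (Module.finrank ℂ F : ℂ)⁻¹ • scalar (traceFun S)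

theorem tracelessPart_apply (S : EndAlg EM F V) (x : M) :
    (tracelessPart S).1 x
      = S.1 x - ((Module.finrank ℂ F : ℂ)⁻¹ * traceFun S x) • (1 : V x →L[ℂ] V x) := by
  rw [mul_smul]
  rfl

theorem trace_tracelessPart (hF : 0 < Module.finrank ℂ F) (S : EndAlg EM F V) (x : M) :
    LinearMap.trace ℂ (V x) ((tracelessPart S).1 x).toLinearMap = 0 := by
  have : (Module.finrank ℂ F : ℂ) ≠ 0 := by exact_mod_cast hF.ne'
  rw [tracelessPart_apply, ContinuousLinearMap.toLinearMap_sub, map_sub, trace_smul_one F,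
    mul_inv_cancel_left₀ this, traceFun_apply, sub_self]

/-- A family of endomorphisms which commutes with all smooth endomorphism fields is scalar. -/
theorem eq_trace_smul_one (hF : 0 < Module.finrank ℂ F) {x : M} (S : EndAlg EM F V)
    (hS : ∀ T : EndAlg EM F V, S.1 x * T.1 x = T.1 x * S.1 x) :
    S.1 x = ((Module.finrank ℂ F : ℂ)⁻¹ * traceFun S x) • (1 : V x →L[ℂ] V x) := by
  have h := eq_zero_of_commute_of_trace hF ((tracelessPart S).1 x) (fun T => by
    rw [tracelessPart_apply, sub_mul, mul_sub, hS T, smul_one_mul, mul_smul_one])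
    (trace_tracelessPart hF S x)
  rw [tracelessPart_apply] at h
  exact sub_eq_zero.1 h

/-- Every derivation of `Γ(End(E))` has an image. -/
theorem exists_isImage (hF : 0 < Module.finrank ℂ F) (D : Der ℂ (EndAlg EM F V)) :
    ∃ X, IsImage D X := by
  -- `D` preserves the centre, so `D (f • 1)` is a scalar field. Its coefficient is the normalized
  -- trace, which depends smoothly on the point.
  have hc : ∀ f x, (D.1 (scalar f)).1 x = ((Module.finrank ℂ F : ℂ)⁻¹
      * traceFun (D.1 (scalar f)) x) • (1 : V x →L[ℂ] V x) := fun f x =>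
    eq_trace_smul_one hF _ fun T => (congrFun (congrArg Subtype.val
      (Der.map_center D ⟨_, scalar_mem_center f⟩ T)) x).symm
  have hδ : ∀ x, IsPointDerivation (EM := EM) x fun f =>
      (Module.finrank ℂ F : ℂ)⁻¹ * traceFun (D.1 (scalar f)) x := by
    refine fun x => ⟨fun f g h hh => ?_, fun f g h hh => ?_, fun f c hh => ?_⟩
    all_goals refine smul_one_injective (V := V) F hF x ?_
    · have he : (scalar h : EndAlg EM F V) = scalar f + scalar g := EndAlg.ext fun y => by
        change h y • (1 : V y →L[ℂ] V y) = f y • 1 + g y • 1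
        rw [hh, add_smul]
      rw [← hc, he, der_add, add_smul, ← hc, ← hc]
      rfl
    · have he : (scalar h : EndAlg EM F V) = scalar f * scalar g := EndAlg.ext fun y => by
        change h y • (1 : V y →L[ℂ] V y) = (f y • 1) * (g y • 1)
        rw [hh, smul_mul_smul_comm, one_mul]
      rw [← hc, he, Der.leibniz D, add_smul]
      change (D.1 (scalar f)).1 x * (g x • 1) + (f x • 1) * (D.1 (scalar g)).1 x = _
      rw [hc, hc, smul_mul_smul_comm, smul_mul_smul_comm, one_mul]
    · have he : (scalar f : EndAlg EM F V) = c • 1 := EndAlg.ext fun y => by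
        change f y • (1 : V y →L[ℂ] V y) = c • 1
        rw [hh]
      rw [← hc, he, der_smul, der_one, smul_zero, zero_smul]
      rfl
  obtain ⟨X, hX⟩ := exists_cVectorField hδ
    fun f => contMDiff_mul contMDiff_const (traceFun (D.1 (scalar f))).contMDiff
  refine ⟨X, fun f x => ?_⟩
  rw [← hX]
  exact hc f x

/-- A complex vector field is determined by the derivatives of smooth functions. -/
theorem CVectorField.eq_of_deriv {X Y : CVectorField EM M}
    (h : ∀ (f : C^∞⟮𝓘(ℝ, EM), M; 𝓘(ℝ, ℂ), ℂ⟯) x, X.deriv f x = Y.deriv f x) : X = Y := by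
  have key : ∀ x, X.re x - Y.re x = 0 ∧ X.im x - Y.im x = 0 := fun x =>
    tangent_eq_zero fun f => by
      have h1 := h f x
      simp only [deriv] at h1
      rw [map_sub, map_sub]
      linear_combination h1
  exact CVectorField.ext' (fun x => sub_eq_zero.1 (key x).1) fun x => sub_eq_zero.1 (key x).2

theorem existsUnique_isImage (hF : 0 < Module.finrank ℂ F) (D : Der ℂ (EndAlg EM F V)) :
    ∃! X, IsImage D X := by
  obtain ⟨X, hX⟩ := exists_isImage hF D
  refine ⟨X, hX, fun Y hY => CVectorField.eq_of_deriv fun f x => ?_⟩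
  exact smul_one_injective F hF x ((hY f x).symm.trans (hX f x))

/-- A derivation which annihilates the scalars is locally inner. -/
theorem exists_locally_inner (hF : 0 < Module.finrank ℂ F) (D : Der ℂ (EndAlg EM F V))
    (hD : ∀ f, D.1 (scalar f) = 0) (x₀ : M) : ∃ β : EndAlg EM F V,
      ∀ᶠ x in 𝓝 x₀, ∀ S : EndAlg EM F V, (D.1 S).1 x = β.1 x * S.1 x - S.1 x * β.1 x := by
  obtain ⟨l⟩ := exists_localFrame (EM := EM) (F := F) (V := V) x₀ rfl
  let o : Fin (Module.finrank ℂ F) := ⟨0, hF⟩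
  let d : Fin (Module.finrank ℂ F) → Sec EM F V := fun j => actSec (D.1 (l.unit j o)) (l.e o)
  -- This is `∑ j, D(E_jo) E_oj` in terms of the matrix units.
  let β : EndAlg EM F V := ∑ j, rankOne (l.φ j) (l.contMDiff_φ j) (d j)
  have hβ : ∀ x v, β.1 x v = ∑ j, l.φ j x v • d j x := by
    intro x v
    rw [EndAlg.sum_apply, _root_.sum_apply]
    rfl
  refine ⟨β, ?_⟩
  -- The frame identities are needed on a neighbourhood of `x`, since `D` at `x` depends on germs.
  filter_upwards [eventually_eventually_nhds.2 l.eventually_isFrameAt] with x hx S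
  have hxs : l.IsFrameAt x := hx.self_of_nhds
  have key : ∀ j, (D.1 S).1 x (l.e j x) + S.1 x (d j x) = β.1 x (S.1 x (l.e j x)) := by
    intro j
    let c : Fin (Module.finrank ℂ F) → C^∞⟮𝓘(ℝ, EM), M; 𝓘(ℝ, ℂ), ℂ⟯ :=
      fun k => l.coord k (actSec S (l.e j))
    -- Near `x` one has `S E_jo = ∑ k, S_kj E_ko`. Since `D` annihilates the scalar coefficients
    -- `S_kj`, applying it and evaluating at `e o` gives `(D S) e_j + S (β e_j) = β (S e_j)`.
    have h1 : (D.1 (S * l.unit j o)).1 x = (D.1 (∑ k, scalar (c k) * l.unit k o)).1 x := by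
      refine der_congr D ?_
      filter_upwards [hx] with y hy
      ext v
      rw [EndAlg.sum_apply, _root_.sum_apply]
      change S.1 y (l.φ o y v • l.e j y) = ∑ k, l.φ k y (S.1 y (l.e j y)) • l.φ o y v • l.e k y
      rw [map_smul]
      refine (congrArg (l.φ o y v • ·) (hy.2 (S.1 y (l.e j y))).symm).trans ?_
      simp only [Finset.smul_sum]
      exact Finset.sum_congr rfl fun k _ => smul_comm _ _ _
    rw [der_sum, EndAlg.sum_apply, Der.leibniz D] at h1
    have h2 := DFunLike.congr_fun h1 (l.e o x)
    rw [_root_.sum_apply] at h2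
    have h3 : (D.1 S * l.unit j o + S * D.1 (l.unit j o)).1 x (l.e o x)
        = (D.1 S).1 x (l.e j x) + S.1 x (d j x) := by
      change (D.1 S).1 x (l.φ o x (l.e o x) • l.e j x) + _ = _
      rw [hxs.1, if_pos rfl, one_smul]
      rfl
    rw [← h3, h2, hβ]
    refine Finset.sum_congr rfl fun k _ => ?_
    rw [Der.leibniz D, hD, zero_mul, zero_add]
    rfl
  have hβe : ∀ j, β.1 x (l.e j x) = d j x := by
    intro j
    rw [hβ]
    simp [hxs.1]
  ext v
  have h4 : ∀ T : V x →L[ℂ] V x, T v = ∑ j, l.φ j x v • T (l.e j x) := by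
    intro T
    have h5 := congrArg T (hxs.2 v)
    rw [map_sum] at h5
    rw [← h5]
    exact Finset.sum_congr rfl fun j _ => map_smul _ _ _
  rw [h4, h4 (_ - _)]
  refine Finset.sum_congr rfl fun j _ => congrArg (l.φ j x v • ·) ?_
  change _ = β.1 x (S.1 x (l.e j x)) - S.1 x (β.1 x (l.e j x))
  rw [hβe, ← key, add_sub_cancel_right]

/-- A derivation which annihilates the scalars is inner, with a traceless generator. -/
theorem exists_traceless_inner (hF : 0 < Module.finrank ℂ F) (D : Der ℂ (EndAlg EM F V))
    (hD : ∀ f, D.1 (scalar f) = 0) : ∃ α : EndAlg EM F V,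
      (∀ x, LinearMap.trace ℂ (V x) (α.1 x).toLinearMap = 0) ∧ ∀ S, D.1 S = α * S - S * α := by
  choose β hβ using fun x₀ => exists_locally_inner hF D hD x₀
  have hβ' : ∀ x₀ : M, ∀ᶠ x in 𝓝 x₀, ∀ S : EndAlg EM F V, (D.1 S).1 x
      = (tracelessPart (β x₀)).1 x * S.1 x - S.1 x * (tracelessPart (β x₀)).1 x := by
    intro x₀
    filter_upwards [hβ x₀] with x hx S
    rw [hx S, tracelessPart_apply, sub_mul, mul_sub, smul_one_mul, mul_smul_one,
      sub_sub_sub_cancel_right]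
  -- At `x` the generator obtained around `x` itself is used. Near `x₀` it coincides with the one
  -- obtained around `x₀`: both are traceless with the same commutators, so their difference is a
  -- traceless scalar. This gives smoothness.
  refine ⟨⟨fun x => (tracelessPart (β x)).1 x, isSmoothEnd_of_locally fun x₀ =>
    ⟨tracelessPart (β x₀), ?_⟩⟩, fun x => trace_tracelessPart hF _ x, fun S =>
    EndAlg.ext fun x => (hβ' x).self_of_nhds S⟩
  filter_upwards [hβ' x₀] with x hx
  refine sub_eq_zero.1 (eq_zero_of_commute_of_trace (EM := EM) hF _ (fun S => ?_) ?_)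
  · have h1 := (hβ' x).self_of_nhds S
    rw [hx S] at h1
    rw [sub_mul, mul_sub, sub_eq_sub_iff_sub_eq_sub]
    exact h1.symm
  · rw [ContinuousLinearMap.toLinearMap_sub, map_sub, trace_tracelessPart hF,
      trace_tracelessPart hF, sub_self]

end Derivations

end SUBundle
end

/-! ### Complex linear connections on smooth sections -/

noncomputable section

namespace SUBundle

open DerCalc
open scoped Topology

section Connections

variable {EM : Type*} [NormedAddCommGroup EM] [NormedSpace ℝ EM]
  {M : Type*} [TopologicalSpace M] [ChartedSpace EM M]
  {F : Type*} [NormedAddCommGroup F] [NormedSpace ℂ F]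
  {V : M → Type*} [∀ x, AddCommGroup (V x)] [∀ x, Module ℂ (V x)]
  [TopologicalSpace (TotalSpace F V)] [∀ x, TopologicalSpace (V x)]
  [∀ x, IsTopologicalAddGroup (V x)] [∀ x, ContinuousSMul ℂ (V x)]
  [FiberBundle F V] [VectorBundle ℂ F V] [VectorBundle ℝ F V]
  [ContMDiffVectorBundle ∞ F V 𝓘(ℝ, EM)]

theorem actSec_add (S : EndAlg EM F V) (s t : Sec EM F V) :
    actSec S (s + t) = actSec S s + actSec S t :=
  ContMDiffSection.ext fun x => map_add (S.1 x) (s x) (t x)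

theorem actSec_sub (S : EndAlg EM F V) (s t : Sec EM F V) :
    actSec S (s - t) = actSec S s - actSec S t :=
  ContMDiffSection.ext fun x => map_sub (S.1 x) (s x) (t x)

theorem actSec_mul (S T : EndAlg EM F V) (s : Sec EM F V) :
    actSec (S * T) s = actSec S (actSec T s) := rfl

theorem add_actSec (S T : EndAlg EM F V) (s : Sec EM F V) :
    actSec (S + T) s = actSec S s + actSec T s := rfl

theorem sub_actSec (S T : EndAlg EM F V) (s : Sec EM F V) :
    actSec (S - T) s = actSec S s - actSec T s := rfl

theorem actSec_smulSec (S : EndAlg EM F V) (f : C^∞⟮𝓘(ℝ, EM), M; 𝓘(ℝ, ℂ), ℂ⟯)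
    (s : Sec EM F V) : actSec S (smulSec f s) = smulSec f (actSec S s) :=
  ContMDiffSection.ext fun x => map_smul (S.1 x) (f x) (s x)

variable [FiniteDimensional ℝ EM] [T2Space M] [IsManifold 𝓘(ℝ, EM) ∞ M] [FiniteDimensional ℂ F]

theorem eq_of_actSec {S T : EndAlg EM F V} (h : ∀ s, actSec S s = actSec T s) : S = T := by
  refine EndAlg.ext fun x => ContinuousLinearMap.ext fun v => ?_
  obtain ⟨s, rfl⟩ := exists_sec_apply_eq (EM := EM) (F := F) x v
  exact DFunLike.congr_fun (h s) x

/-- The derivative of a smooth function along a complex vector field. -/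
def CVectorField.derivFun (X : CVectorField EM M) (f : C^∞⟮𝓘(ℝ, EM), M; 𝓘(ℝ, ℂ), ℂ⟯) :
    C^∞⟮𝓘(ℝ, EM), M; 𝓘(ℝ, ℂ), ℂ⟯ :=
  ⟨X.deriv f, X.contMDiff_deriv f.contMDiff⟩

variable (nabla : CovariantDerivative 𝓘(ℝ, EM) F V)

theorem mdifferentiableAt_sec (s : Sec EM F V) (x : M) :
    MDifferentiableAt 𝓘(ℝ, EM) (𝓘(ℝ, EM).prod 𝓘(ℝ, F))
      (fun y => TotalSpace.mk' F (E := V) y (s y)) x :=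
  s.contMDiff.mdifferentiable (by simp) x

theorem nabla_add (s t : Sec EM F V) (x : M) : nabla (s + t : Sec EM F V) x = nabla s x + nabla t x :=
  nabla.isCovariantDerivativeOnUniv.add (mdifferentiableAt_sec s x) (mdifferentiableAt_sec t x)

theorem nabla_congr {s t : Sec EM F V} {x : M} (h : ∀ᶠ y in 𝓝 x, s y = t y) :
    nabla s x = nabla t x :=
  nabla.isCovariantDerivativeOnUniv.congr_of_eventuallyEq (mdifferentiableAt_sec s x)
    (mdifferentiableAt_sec t x) Filter.univ_mem h

variable {nabla}

/-- A covariant derivative satisfies the Leibniz rule for real functions only. Writing `f` as real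
part plus `I` times imaginary part reduces the complex rule to two real ones and complex linearity.
-/
theorem nabla_smulSec (hlin : IsComplexLinear nabla) (f : C^∞⟮𝓘(ℝ, EM), M; 𝓘(ℝ, ℂ), ℂ⟯)
    (s : Sec EM F V) (x : M) (v : TangentSpace 𝓘(ℝ, EM) x) :
    nabla (smulSec f s) x v = f x • nabla s x v + mvfderiv 𝓘(ℝ, EM) f x v • s x := by
  have hf : MDifferentiableAt 𝓘(ℝ, EM) 𝓘(ℝ, ℂ) f x := f.contMDiff.mdifferentiable (by simp) x
  have hreal : ∀ L : ℂ →L[ℝ] ℝ, ∃ t : Sec EM F V, (∀ y, t y = ((L (f y) : ℝ) : ℂ) • s y) ∧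
      nabla t x v = ((L (f x) : ℝ) : ℂ) • nabla s x v
        + ((L (mvfderiv 𝓘(ℝ, EM) f x v) : ℝ) : ℂ) • s x := by
    intro L
    have hL : ContMDiff 𝓘(ℝ, EM) 𝓘(ℝ, ℝ) ∞ fun y => L (f y) :=
      L.contDiff.contMDiff.comp f.contMDiff
    refine ⟨smulSec ⟨_, contMDiff_ofReal hL⟩ s, fun y => rfl, ?_⟩
    have h1 := DFunLike.congr_fun (nabla.isCovariantDerivativeOnUniv.leibniz
      (mdifferentiableAt_sec s x) (hL.mdifferentiable (by simp) x)) v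
    rw [← mvfderiv_clm_comp L hf v]
    exact h1
  obtain ⟨a, ha, ha'⟩ := hreal Complex.reCLM
  obtain ⟨b, hb, hb'⟩ := hreal Complex.imCLM
  let c : C^∞⟮𝓘(ℝ, EM), M; 𝓘(ℝ, ℂ), ℂ⟯ := ⟨fun _ => Complex.I, contMDiff_const⟩
  have h2 : smulSec f s = a + smulSec c b := by
    ext y
    change f y • s y = a y + Complex.I • b y
    rw [ha, hb, ← mul_smul, ← add_smul]
    congr 1
    rw [mul_comm]
    exact (Complex.re_add_im (f y)).symm
  rw [h2, nabla_add]
  have h3 : nabla (smulSec c b) x v = Complex.I • nabla b x v := hlin Complex.I b x v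
  have h4 : ∀ z : ℂ, ((Complex.reCLM z : ℝ) : ℂ) + Complex.I * ((Complex.imCLM z : ℝ) : ℂ) = z := by
    intro z
    rw [mul_comm]
    exact Complex.re_add_im z
  rw [add_apply, h3, ha', hb']
  conv_rhs => rw [← h4 (f x), ← h4 (mvfderiv 𝓘(ℝ, EM) f x v)]
  module

variable (nabla) [CovariantDerivative.ContMDiffCovariantDerivative nabla ∞]

/-- The covariant derivative of a smooth section along a real vector field. -/
def realCovSec (X : Cₛ^∞⟮𝓘(ℝ, EM); EM, (TangentSpace 𝓘(ℝ, EM) : M → Type _)⟯)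
    (s : Sec EM F V) : Sec EM F V :=
  ⟨fun x => nabla s x (X x), by
    have h := (CovariantDerivative.ContMDiffCovariantDerivative.contMDiff
      (cov := nabla) (k := ∞)).contMDiff (σ := s) (by
        simpa using s.contMDiff.contMDiffOn)
    exact ContMDiff.clm_bundle_apply (contMDiffOn_univ.1 h) X.contMDiff⟩

/-- The covariant derivative of a smooth section along a complex vector field. -/
def covSec (X : CVectorField EM M) (s : Sec EM F V) : Sec EM F V :=
  realCovSec nabla X.re s + smulSec ⟨fun _ => Complex.I, contMDiff_const⟩ (realCovSec nabla X.im s)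

theorem covSec_apply (X : CVectorField EM M) (s : Sec EM F V) (x : M) :
    covSec nabla X s x = nabla s x (X.re x) + Complex.I • nabla s x (X.im x) := rfl

theorem covSec_add (X : CVectorField EM M) (s t : Sec EM F V) :
    covSec nabla X (s + t) = covSec nabla X s + covSec nabla X t := by
  ext x
  change _ = covSec nabla X s x + covSec nabla X t x
  simp only [covSec_apply, nabla_add, add_apply]
  module

theorem covSec_sum (X : CVectorField EM M) {ι : Type*} (a : Finset ι) (s : ι → Sec EM F V) :
    covSec nabla X (∑ i ∈ a, s i) = ∑ i ∈ a, covSec nabla X (s i) :=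
  map_sum (AddMonoidHom.mk' (covSec nabla X) (covSec_add nabla X)) s a

theorem covSec_congr (X : CVectorField EM M) {s t : Sec EM F V} {x : M}
    (h : ∀ᶠ y in 𝓝 x, s y = t y) : covSec nabla X s x = covSec nabla X t x := by
  rw [covSec_apply, covSec_apply, nabla_congr nabla h]

variable {nabla}

theorem covSec_smulSec (hlin : IsComplexLinear nabla) (X : CVectorField EM M) (f : C^∞⟮𝓘(ℝ, EM), M; 𝓘(ℝ, ℂ), ℂ⟯)
    (s : Sec EM F V) :
    covSec nabla X (smulSec f s) = smulSec f (covSec nabla X s) + smulSec (X.derivFun f) s := by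
  ext x
  change _ = f x • covSec nabla X s x + X.deriv f x • s x
  simp only [covSec_apply, nabla_smulSec hlin, CVectorField.deriv]
  module

end Connections

end SUBundle
end

/-! ### The induced connection on endomorphisms -/

noncomputable section

namespace SUBundle

open DerCalc
open scoped Topology

section Curvature

variable {EM : Type*} [NormedAddCommGroup EM] [NormedSpace ℝ EM]
  {M : Type*} [TopologicalSpace M] [ChartedSpace EM M]
  {F : Type*} [NormedAddCommGroup F] [NormedSpace ℂ F]
  {V : M → Type*} [∀ x, AddCommGroup (V x)] [∀ x, Module ℂ (V x)]
  [TopologicalSpace (TotalSpace F V)] [∀ x, TopologicalSpace (V x)]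
  [∀ x, IsTopologicalAddGroup (V x)] [∀ x, ContinuousSMul ℂ (V x)]
  [FiberBundle F V] [VectorBundle ℂ F V] [VectorBundle ℝ F V]
  [ContMDiffVectorBundle ∞ F V 𝓘(ℝ, EM)]
  [FiniteDimensional ℝ EM] [T2Space M] [IsManifold 𝓘(ℝ, EM) ∞ M] [FiniteDimensional ℂ F]
  {nabla : CovariantDerivative 𝓘(ℝ, EM) F V}
  [CovariantDerivative.ContMDiffCovariantDerivative nabla ∞]

theorem covSec_sub (X : CVectorField EM M) (s t : Sec EM F V) :
    covSec nabla X (s - t) = covSec nabla X s - covSec nabla X t :=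
  map_sub (AddMonoidHom.mk' (covSec nabla X) (covSec_add nabla X)) s t

theorem smulSec_sub (f : C^∞⟮𝓘(ℝ, EM), M; 𝓘(ℝ, ℂ), ℂ⟯) (s t : Sec EM F V) :
    smulSec f (s - t) = smulSec f s - smulSec f t := actSec_sub _ s t

/-- The induced connection on `End(E)` as an operator on `Γ(End(E))`. -/
theorem exists_covEnd (hlin : IsComplexLinear nabla) (X : CVectorField EM M) (S : EndAlg EM F V) :
    ∃ T : EndAlg EM F V, ∀ s,
      actSec T s = covSec nabla X (actSec S s) - actSec S (covSec nabla X s) := by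
  obtain ⟨T, hT⟩ := exists_actSec_eq
    (fun s => covSec nabla X (actSec S s) - actSec S (covSec nabla X s))
    (fun s t => by
      simp only [actSec_add, covSec_add]
      abel)
    -- Both terms of the commutator produce the derivative term `(X f) • S s`; these cancel, so the
    -- operator is linear over functions.
    (fun f s => by
      simp only [actSec_smulSec, covSec_smulSec hlin, actSec_add, smulSec_sub]
      abel)
  exact ⟨T, fun s => (hT s).symm⟩

/-- The covariant derivative of an endomorphism field. -/
def covEndo (hlin : IsComplexLinear nabla) (X : CVectorField EM M) (S : EndAlg EM F V) :
    EndAlg EM F V :=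
  (exists_covEnd hlin X S).choose

theorem actSec_covEndo (hlin : IsComplexLinear nabla) (X : CVectorField EM M)
    (S : EndAlg EM F V) (s : Sec EM F V) : actSec (covEndo hlin X S) s
      = covSec nabla X (actSec S s) - actSec S (covSec nabla X s) :=
  (exists_covEnd hlin X S).choose_spec s

theorem act_covEndo (hlin : IsComplexLinear nabla) (X : CVectorField EM M)
    (S : EndAlg EM F V) (s : Sec EM F V) : act (covEndo hlin X S) s = covEnd nabla X S s :=
  congrArg (fun t : Sec EM F V => (t : ∀ x, V x)) (actSec_covEndo hlin X S s)

/-- The covariant derivative along a complex vector field as a derivation of `Γ(End(E))`. -/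
def covDer (hlin : IsComplexLinear nabla) (X : CVectorField EM M) : Der ℂ (EndAlg EM F V) :=
  ⟨{  toFun := covEndo hlin X
      map_add' := fun S T => eq_of_actSec fun s => by
        simp only [add_actSec, actSec_covEndo, covSec_add]
        abel
      map_smul' := fun c S => eq_of_actSec fun s => by
        let f : C^∞⟮𝓘(ℝ, EM), M; 𝓘(ℝ, ℂ), ℂ⟯ := ⟨fun _ => c, contMDiff_const⟩
        have h1 : ∀ (T : EndAlg EM F V) t, actSec (c • T) t = smulSec f (actSec T t) :=
          fun T t => rfl
        have h2 : ∀ t : Sec EM F V, smulSec (X.derivFun f) t = 0 := by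
          intro t
          ext x
          change X.deriv (fun _ => c) x • t x = 0
          rw [X.deriv_const, zero_smul]
        simp only [RingHom.id_apply, h1, actSec_covEndo, covSec_smulSec hlin, h2, add_zero,
          smulSec_sub] },
    fun S T => eq_of_actSec fun s => by
      change actSec (covEndo hlin X (S * T)) s
        = actSec (covEndo hlin X S * T + S * covEndo hlin X T) s
      simp only [add_actSec, actSec_mul, actSec_covEndo, actSec_sub]
      abel⟩

theorem covDer_apply (hlin : IsComplexLinear nabla) (X : CVectorField EM M) (S : EndAlg EM F V) :
    (covDer hlin X).1 S = covEndo hlin X S := rfl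

theorem covEndo_scalar (hlin : IsComplexLinear nabla) (X : CVectorField EM M)
    (f : C^∞⟮𝓘(ℝ, EM), M; 𝓘(ℝ, ℂ), ℂ⟯) :
    covEndo (V := V) hlin X (scalar f) = scalar (X.derivFun f) :=
  eq_of_actSec fun s => by
    rw [actSec_covEndo]
    change covSec nabla X (smulSec f s) - smulSec f (covSec nabla X s) = smulSec (X.derivFun f) s
    rw [covSec_smulSec hlin, add_sub_cancel_left]

theorem isImage_covDer (hlin : IsComplexLinear nabla) (X : CVectorField EM M) :
    IsImage (covDer hlin X) X := fun f x => by
  rw [covDer_apply, covEndo_scalar]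
  rfl

/-- The covariant derivative in a local frame. -/
theorem LocalFrame.φ_covSec (hlin : IsComplexLinear nabla) {n : ℕ} {x₀ : M}
    (l : LocalFrame (EM := EM) F V x₀ n) {x : M} (hx : ∀ᶠ y in 𝓝 x, l.IsFrameAt y)
    (X : CVectorField EM M) (t : Sec EM F V) (i : Fin n) :
    l.φ i x (covSec nabla X t x) = X.deriv (l.coord i t) x
      + ∑ j, l.φ j x (t x) * l.φ i x (covSec nabla X (l.e j) x) := by
  have hxs : l.IsFrameAt x := hx.self_of_nhds
  have h1 : covSec nabla X t x
      = (∑ j, covSec nabla X (smulSec (l.coord j t) (l.e j)) : Sec EM F V) x := by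
    rw [← covSec_sum]
    refine covSec_congr nabla X ?_
    filter_upwards [hx] with y hy
    rw [sum_sec_apply]
    exact (hy.2 (t y)).symm
  have h2 : ∀ j, l.φ i x (covSec nabla X (smulSec (l.coord j t) (l.e j)) x)
      = l.φ j x (t x) * l.φ i x (covSec nabla X (l.e j) x)
        + X.deriv (l.coord j t) x * if i = j then 1 else 0 := by
    intro j
    rw [covSec_smulSec hlin, ← hxs.1 i j]
    change l.φ i x (l.φ j x (t x) • covSec nabla X (l.e j) x
      + X.deriv (l.coord j t) x • l.e j x) = _
    rw [map_add, map_smul, map_smul, smul_eq_mul, smul_eq_mul]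
  rw [h1, sum_sec_apply, map_sum, Finset.sum_congr rfl fun j _ => h2 j, Finset.sum_add_distrib,
    add_comm]
  simp

theorem CVectorField.deriv_add (X : CVectorField EM M) (f g : C^∞⟮𝓘(ℝ, EM), M; 𝓘(ℝ, ℂ), ℂ⟯)
    (x : M) : X.deriv (fun y => f y + g y) x = X.deriv f x + X.deriv g x := by
  have hf : MDifferentiableAt 𝓘(ℝ, EM) 𝓘(ℝ, ℂ) f x := f.contMDiff.mdifferentiable (by simp) x
  have hg : MDifferentiableAt 𝓘(ℝ, EM) 𝓘(ℝ, ℂ) g x := g.contMDiff.mdifferentiable (by simp) x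
  have h : ∀ v : TangentSpace 𝓘(ℝ, EM) x, mvfderiv 𝓘(ℝ, EM) (fun y => f y + g y) x v
      = mvfderiv 𝓘(ℝ, EM) f x v + mvfderiv 𝓘(ℝ, EM) g x v := fun v =>
    DFunLike.congr_fun (hf.hasMFDerivAt.add hg.hasMFDerivAt).mfderiv v
  simp only [deriv, h]
  ring

theorem CVectorField.deriv_sum (X : CVectorField EM M) {ι : Type*} (a : Finset ι)
    (f : ι → C^∞⟮𝓘(ℝ, EM), M; 𝓘(ℝ, ℂ), ℂ⟯) (x : M) :
    X.deriv (fun y => ∑ i ∈ a, f i y) x = ∑ i ∈ a, X.deriv (f i) x := by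
  classical
  induction a using Finset.induction_on with
  | empty => simpa using X.deriv_const 0 x
  | insert i a hi ih =>
    let g : C^∞⟮𝓘(ℝ, EM), M; 𝓘(ℝ, ℂ), ℂ⟯ :=
      ⟨fun y => ∑ i ∈ a, f i y, contMDiff_finsetSum fun i _ => (f i).contMDiff⟩
    have h := X.deriv_add (f i) g x
    rw [Finset.sum_insert hi, ← ih]
    refine Eq.trans ?_ h
    congr 1
    funext y
    rw [Finset.sum_insert hi]
    rfl

/-- The trace of a covariant derivative is the derivative of the trace. -/
theorem trace_covEndo (hlin : IsComplexLinear nabla) (X : CVectorField EM M) (S : EndAlg EM F V)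
    (x : M) : LinearMap.trace ℂ (V x) ((covEndo hlin X S).1 x).toLinearMap
      = X.deriv (traceFun S) x := by
  obtain ⟨l⟩ := exists_localFrame (EM := EM) (F := F) (V := V) x rfl
  have hx := l.isFrameAt_self
  have h1 : X.deriv (traceFun S) x = X.deriv (fun y => ∑ i, l.coord i (actSec S (l.e i)) y) x := by
    refine X.deriv_congr ?_
    filter_upwards [l.eventually_isFrameAt] with y hy
    exact hy.trace_eq _
  rw [h1, X.deriv_sum, hx.trace_eq]
  have h2 : ∀ i, l.φ i x ((covEndo hlin X S).1 x (l.e i x))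
      = X.deriv (l.coord i (actSec S (l.e i))) x
        + ∑ j, l.φ j x (S.1 x (l.e i x)) * l.φ i x (covSec nabla X (l.e j) x)
        - ∑ j, l.φ j x (covSec nabla X (l.e i) x) * l.φ i x (S.1 x (l.e j x)) := by
    intro i
    have h3 := l.φ_covSec hlin l.eventually_isFrameAt X (actSec S (l.e i)) i
    rw [actSec_apply] at h3
    rw [← h3, ← actSec_apply, actSec_covEndo]
    change l.φ i x (covSec nabla X (actSec S (l.e i)) x - S.1 x (covSec nabla X (l.e i) x)) = _
    rw [map_sub]
    congr 1
    have h4 := congrArg (fun v => l.φ i x (S.1 x v)) (hx.2 (covSec nabla X (l.e i) x))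
    simp only [map_sum, map_smul, smul_eq_mul] at h4
    exact h4.symm
  rw [Finset.sum_congr rfl fun i _ => h2 i, Finset.sum_sub_distrib, Finset.sum_add_distrib]
  -- With `ω` the connection matrix, the two double sums are `tr (ω S)` and `tr (S ω)`.
  rw [sub_eq_iff_eq_add, add_right_inj, Finset.sum_comm]
  exact Finset.sum_congr rfl fun i _ => Finset.sum_congr rfl fun j _ => mul_comm _ _

end Curvature

end SUBundle
end

/-! ### The volume form and the trace of the curvature -/

noncomputable section

namespace SUBundle

open DerCalc
open scoped Topology

section Volume

variable {EM : Type*} [NormedAddCommGroup EM] [NormedSpace ℝ EM]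
  {M : Type*} [TopologicalSpace M] [ChartedSpace EM M]
  {F : Type*} [NormedAddCommGroup F] [NormedSpace ℂ F]
  {V : M → Type*} [∀ x, AddCommGroup (V x)] [∀ x, Module ℂ (V x)]
  [TopologicalSpace (TotalSpace F V)] [∀ x, TopologicalSpace (V x)]
  [∀ x, IsTopologicalAddGroup (V x)] [∀ x, ContinuousSMul ℂ (V x)]
  [FiberBundle F V] [VectorBundle ℂ F V] [VectorBundle ℝ F V]
  [ContMDiffVectorBundle ∞ F V 𝓘(ℝ, EM)]
  [FiniteDimensional ℝ EM] [T2Space M] [IsManifold 𝓘(ℝ, EM) ∞ M] [FiniteDimensional ℂ F]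

/-- Expanding `v` in the frame, every component other than the `i`-th repeats an argument of the
alternating form and contributes nothing. -/
theorem LocalFrame.IsFrameAt.map_update {n : ℕ} {x₀ x : M}
    {l : LocalFrame (EM := EM) F V x₀ n} (hx : l.IsFrameAt x) (η : V x [⋀^Fin n]→ₗ[ℂ] ℂ)
    (i : Fin n) (v : V x) : η (Function.update (fun j => l.e j x) i v)
      = l.φ i x v * η fun j => l.e j x := by
  have h1 : ∀ j, η (Function.update (fun j => l.e j x) i (l.e j x))
      = if i = j then η fun j => l.e j x else 0 := by
    intro j
    split_ifs with hij
    · subst hij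
      rw [Function.update_eq_self i fun j => l.e j x]
    · exact η.map_update_self (fun j => l.e j x) hij
  let L : V x →ₗ[ℂ] ℂ := η.toMultilinearMap.toLinearMap (fun j => l.e j x) i
  have h2 := congrArg L (hx.2 v)
  rw [map_sum] at h2
  change L v = _
  rw [← h2]
  have h3 : ∀ j, L (l.φ j x v • l.e j x)
      = l.φ j x v * if i = j then η fun j => l.e j x else 0 := by
    intro j
    rw [map_smul, smul_eq_mul, ← h1]
    rfl
  rw [Finset.sum_congr rfl fun j _ => h3 j]
  simp

theorem LocalFrame.IsFrameAt.vol_ne_zero {n : ℕ} {x₀ x : M}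
    {l : LocalFrame (EM := EM) F V x₀ n} (hx : l.IsFrameAt x) {η : V x [⋀^Fin n]→ₗ[ℂ] ℂ}
    (hη : η ≠ 0) : (η fun j => l.e j x) ≠ 0 := by
  have h := (AlternatingMap.map_basis_ne_zero_iff hx.basis η).2 hη
  rwa [show ⇑hx.basis = fun j => l.e j x from funext hx.basis_apply] at h

variable {nabla : CovariantDerivative 𝓘(ℝ, EM) F V}
  [CovariantDerivative.ContMDiffCovariantDerivative nabla ∞]

/-- The trace of the connection matrix in a local frame. -/
def LocalFrame.traceConn (nabla : CovariantDerivative 𝓘(ℝ, EM) F V)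
    [CovariantDerivative.ContMDiffCovariantDerivative nabla ∞] {n : ℕ} {x₀ : M}
    (l : LocalFrame (EM := EM) F V x₀ n) (X : CVectorField EM M) :
    C^∞⟮𝓘(ℝ, EM), M; 𝓘(ℝ, ℂ), ℂ⟯ :=
  ⟨fun x => ∑ i, l.φ i x (covSec nabla X (l.e i) x),
    contMDiff_finsetSum fun i _ => l.contMDiff_φ i _⟩

theorem LocalFrame.traceConn_apply {n : ℕ} {x₀ : M} (l : LocalFrame (EM := EM) F V x₀ n)
    (X : CVectorField EM M) (x : M) :
    l.traceConn nabla X x = ∑ i, l.φ i x (covSec nabla X (l.e i) x) := rfl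

/-- The volume of a local frame. -/
def LocalFrame.volume {n : ℕ} {x₀ : M} (l : LocalFrame (EM := EM) F V x₀ n)
    (su : SUStructure EM F V n) : C^∞⟮𝓘(ℝ, EM), M; 𝓘(ℝ, ℂ), ℂ⟯ :=
  ⟨fun x => su.vol x fun i => l.e i x, su.vol_smooth l.e⟩

/-- Each summand in `PreservesVolume` replaces one frame vector by its covariant derivative, and
only the diagonal entry of the connection matrix survives. The sum is the trace times the volume. -/
theorem LocalFrame.deriv_volume {n : ℕ} {su : SUStructure EM F V n}
    (hvol : PreservesVolume su nabla) {x₀ x : M}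
    (l : LocalFrame (EM := EM) F V x₀ n) (hx : l.IsFrameAt x) (X : CVectorField EM M) :
    X.deriv (l.volume su) x = l.traceConn nabla X x * l.volume su x := by
  have h : ∀ v : TangentSpace 𝓘(ℝ, EM) x, mvfderiv 𝓘(ℝ, EM) (l.volume su) x v
      = (∑ i, l.φ i x (nabla (l.e i) x v)) * l.volume su x := by
    intro v
    rw [Finset.sum_mul]
    exact (hvol l.e x v).trans (Finset.sum_congr rfl fun i _ => hx.map_update _ i _)
  rw [CVectorField.deriv, h, h, ← mul_assoc, ← add_mul, Finset.mul_sum, ← Finset.sum_add_distrib,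
    traceConn_apply]
  congr 1
  refine Finset.sum_congr rfl fun i _ => ?_
  rw [covSec_apply, map_add, map_smul, smul_eq_mul]

/-- The curvature as an operator on smooth sections. -/
def curvSec (nabla : CovariantDerivative 𝓘(ℝ, EM) F V)
    [CovariantDerivative.ContMDiffCovariantDerivative nabla ∞] (X Y : CVectorField EM M)
    (s : Sec EM F V) : Sec EM F V :=
  covSec nabla X (covSec nabla Y s) - covSec nabla Y (covSec nabla X s)
    - covSec nabla (X.bracket Y) s

theorem coe_curvSec (X Y : CVectorField EM M) (s : Sec EM F V) :
    ⇑(curvSec nabla X Y s) = curvature nabla X Y s := rfl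

/-- The terms with one derivative of `f` cancel between the two orders, and those with two
derivatives combine to `[X, Y] f`, which the last term of the curvature removes. -/
theorem curvSec_smulSec (hlin : IsComplexLinear nabla) (X Y : CVectorField EM M)
    (f : C^∞⟮𝓘(ℝ, EM), M; 𝓘(ℝ, ℂ), ℂ⟯) (s : Sec EM F V) :
    curvSec nabla X Y (smulSec f s) = smulSec f (curvSec nabla X Y s) := by
  have h : smulSec ((X.bracket Y).derivFun f) s
      = smulSec (X.derivFun (Y.derivFun f)) s - smulSec (Y.derivFun (X.derivFun f)) s := by
    ext x
    change (X.bracket Y).deriv f x • s x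
      = X.deriv (Y.deriv f) x • s x - Y.deriv (X.deriv f) x • s x
    rw [CVectorField.deriv_bracket X Y f.contMDiff, sub_smul]
  simp only [curvSec, covSec_smulSec hlin, covSec_add, h, smulSec_sub]
  abel

theorem exists_curvature (hlin : IsComplexLinear nabla) (X Y : CVectorField EM M) :
    ∃ R : EndAlg EM F V, ∀ s, curvSec nabla X Y s = actSec R s :=
  exists_actSec_eq (curvSec nabla X Y)
    (fun s t => by
      simp only [curvSec, covSec_add]
      abel)
    (curvSec_smulSec hlin X Y)

/-- The curvature of a volume-preserving connection is traceless. -/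
theorem trace_curvature (hlin : IsComplexLinear nabla) {n : ℕ} (hn : Module.finrank ℂ F = n)
    {su : SUStructure EM F V n} (hvol : PreservesVolume su nabla) {X Y : CVectorField EM M}
    {R : EndAlg EM F V} (hR : ∀ s, curvSec nabla X Y s = actSec R s) (x : M) :
    LinearMap.trace ℂ (V x) (R.1 x).toLinearMap = 0 := by
  obtain ⟨l⟩ := exists_localFrame (EM := EM) (F := F) (V := V) x hn
  have hx := l.isFrameAt_self
  have h1 : ∀ Z W : CVectorField EM M,
      ∑ i, l.φ i x (covSec nabla Z (covSec nabla W (l.e i)) x) = Z.deriv (l.traceConn nabla W) x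
        + ∑ i, ∑ j, l.φ j x (covSec nabla W (l.e i) x) * l.φ i x (covSec nabla Z (l.e j) x) := by
    intro Z W
    rw [Finset.sum_congr rfl fun i _ =>
      l.φ_covSec hlin l.eventually_isFrameAt Z (covSec nabla W (l.e i)) i, Finset.sum_add_distrib]
    congr 1
    exact (Z.deriv_sum Finset.univ (fun i => l.coord i (covSec nabla W (l.e i))) x).symm
  -- With `θ` the trace of the connection matrix, the curvature has trace `X θ(Y) - Y θ(X) - θ([X,
  -- Y])`: the quadratic terms `tr (ω(X) ω(Y))` are symmetric in `X` and `Y`.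
  have h2 : LinearMap.trace ℂ (V x) (R.1 x).toLinearMap = X.deriv (l.traceConn nabla Y) x
      - Y.deriv (l.traceConn nabla X) x - l.traceConn nabla (X.bracket Y) x := by
    have h3 : ∀ i, l.φ i x (R.1 x (l.e i x)) = l.φ i x (covSec nabla X (covSec nabla Y (l.e i)) x)
        - l.φ i x (covSec nabla Y (covSec nabla X (l.e i)) x)
        - l.φ i x (covSec nabla (X.bracket Y) (l.e i) x) := by
      intro i
      rw [← map_sub, ← map_sub, ← actSec_apply, ← hR]
      rfl
    rw [hx.trace_eq, Finset.sum_congr rfl fun i _ => h3 i, Finset.sum_sub_distrib,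
      Finset.sum_sub_distrib, h1, h1, ← l.traceConn_apply]
    have h4 : ∑ i, ∑ j, l.φ j x (covSec nabla Y (l.e i) x) * l.φ i x (covSec nabla X (l.e j) x)
        = ∑ i, ∑ j, l.φ j x (covSec nabla X (l.e i) x) * l.φ i x (covSec nabla Y (l.e j) x) := by
      rw [Finset.sum_comm]
      exact Finset.sum_congr rfl fun i _ => Finset.sum_congr rfl fun j _ => mul_comm _ _
    rw [h4]
    ring
  -- Differentiating `W vol = θ(W) vol` once more. Antisymmetrizing and comparing with `[X, Y] vol =
  -- θ([X, Y]) vol` gives `tr R * vol = 0`, and the volume of a frame is nonzero.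
  have h5 : ∀ Z W : CVectorField EM M, Z.deriv (W.deriv (l.volume su)) x
      = Z.deriv (l.traceConn nabla W) x * l.volume su x
        + l.traceConn nabla W x * (l.traceConn nabla Z x * l.volume su x) := by
    intro Z W
    have h6 : Z.deriv (W.deriv (l.volume su)) x
        = Z.deriv (fun y => l.traceConn nabla W y * l.volume su y) x := by
      refine Z.deriv_congr ?_
      filter_upwards [l.eventually_isFrameAt] with y hy
      exact l.deriv_volume hvol hy W
    rw [h6, Z.deriv_mul ((l.traceConn nabla W).contMDiff.mdifferentiable (by simp) x)
      ((l.volume su).contMDiff.mdifferentiable (by simp) x), l.deriv_volume hvol hx, add_comm]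
  have h7 := CVectorField.deriv_bracket X Y (l.volume su).contMDiff x
  rw [l.deriv_volume hvol hx, h5, h5] at h7
  refine (mul_eq_zero.1 ?_).resolve_right (hx.vol_ne_zero (su.vol_ne_zero x))
  rw [h2]
  change _ * l.volume su x = 0
  linear_combination -h7

end Volume

end SUBundle
end

/-! ### The associated form, its curvature and horizontality -/

noncomputable section

namespace DerCalc

/-- Pure algebra: expanding the twisted operators with the Leibniz rule, the compositions of `D` and
`D'` cancel against their bracket and the rest collects into a single commutator. -/
theorem commutator_curvature {A : Type*} [Ring A] [Algebra ℂ A] (D D' : Der ℂ A) {a b c : A}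
    {N N' N'' : A → A} (hN : ∀ S, N S = D.1 S + (a * S - S * a))
    (hN' : ∀ S, N' S = D'.1 S + (b * S - S * b))
    (hN'' : ∀ S, N'' S = (⁅D, D'⁆ : Der ℂ A).1 S + (c * S - S * c)) (S : A) :
    N (N' S) - N' (N S) - N'' S
      = (D.1 b - D'.1 a - c + (a * b - b * a)) * S
        - S * (D.1 b - D'.1 a - c + (a * b - b * a)) := by
  rw [hN, hN', hN', hN, hN'', Der.lie_apply]
  simp only [map_add, map_sub, Der.leibniz D, Der.leibniz D']
  noncomm_ring

theorem commutator_mul_add {A : Type*} [Ring A] {z S : A} (hz : S * z = z * S) (a b : A) :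
    (z * a + b) * S - S * (z * a + b) = z * (a * S - S * a) + (b * S - S * b) := by
  rw [mul_add, ← mul_assoc S, hz, mul_sub, add_mul, mul_assoc, mul_assoc]
  abel

/-- A `1`-form from a map which is linear over the centre. -/
def Form₁.ofSMulAdd {A : Type*} [Ring A] [Algebra ℂ A] (w : Der ℂ A → A)
    (hw : ∀ (z : Z ℂ A) (D D' : Der ℂ A), w (z • D + D') = z.1 * w D + w D') : Form₁ ℂ A :=
  have hadd : ∀ D D' : Der ℂ A, w (D + D') = w D + w D' := fun D D' => by
    have h := hw 1 D D'
    rw [one_smul] at h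
    exact h.trans (congrArg (· + w D') (one_mul _))
  have h0 : w 0 = 0 := by
    have h := hadd 0 0
    rw [add_zero] at h
    exact left_eq_add.1 h
  { toFun := w
    map_add' := hadd
    map_smul' := fun z D => by
      have h := hw z D 0
      rwa [h0, add_zero, add_zero] at h }

theorem Form₁.ext' {A : Type*} [Ring A] [Algebra ℂ A] {a b : Form₁ ℂ A} (h : ∀ D, a D = b D) :
    a = b := LinearMap.ext h

theorem d₁_add_lie {A : Type*} [Ring A] [Algebra ℂ A] (a : Form₁ ℂ A) (D D' : Der ℂ A) :
    (d₁ a).1 D D' + ⁅a D, a D'⁆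
      = D.1 (a D') - D'.1 (a D) - a ⁅D, D'⁆ + (a D * a D' - a D' * a D) := rfl

theorem isHorizontal_d₁_add_sq₁ {A : Type*} [Ring A] [Algebra ℂ A] {a : Form₁ ℂ A}
    (h : ∀ γ D, (d₁ a).1 (inner γ) D + ⁅a (inner γ), a D⁆ = 0) :
    IsHorizontal (d₁ a + sq₁ a) := h

abbrev derAdd (A : Type*) [Ring A] [Algebra ℂ A] : Add (Der ℂ A) := inferInstance

abbrev derSub (A : Type*) [Ring A] [Algebra ℂ A] : Sub (Der ℂ A) := inferInstance

end DerCalc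

namespace SUBundle

open DerCalc
open scoped Topology

section Associated

attribute [local instance] derAdd derSub

variable {EM : Type*} [NormedAddCommGroup EM] [NormedSpace ℝ EM]
  {M : Type*} [TopologicalSpace M] [ChartedSpace EM M]
  {F : Type*} [NormedAddCommGroup F] [NormedSpace ℂ F]
  {V : M → Type*} [∀ x, AddCommGroup (V x)] [∀ x, Module ℂ (V x)]
  [TopologicalSpace (TotalSpace F V)] [∀ x, TopologicalSpace (V x)]
  [∀ x, IsTopologicalAddGroup (V x)] [∀ x, ContinuousSMul ℂ (V x)]
  [FiberBundle F V] [VectorBundle ℂ F V] [VectorBundle ℝ F V]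
  [ContMDiffVectorBundle ∞ F V 𝓘(ℝ, EM)]
  [FiniteDimensional ℝ EM] [T2Space M] [IsManifold 𝓘(ℝ, EM) ∞ M] [FiniteDimensional ℂ F]

theorem IsImage.apply_scalar {D : Der ℂ (EndAlg EM F V)} {X : CVectorField EM M}
    (h : IsImage D X) (f : C^∞⟮𝓘(ℝ, EM), M; 𝓘(ℝ, ℂ), ℂ⟯) :
    D.1 (scalar f) = scalar (X.derivFun f) :=
  EndAlg.ext fun x => h f x

/-- On scalars, `D` and `D'` act as `X` and `Y`, so their commutator acts as `X Y - Y X`. -/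
theorem IsImage.lie {D D' : Der ℂ (EndAlg EM F V)} {X Y : CVectorField EM M}
    (hX : IsImage D X) (hY : IsImage D' Y) : IsImage ⁅D, D'⁆ (X.bracket Y) := by
  intro f x
  rw [Der.lie_apply, hX.apply_scalar, hY.apply_scalar, hX.apply_scalar, hY.apply_scalar,
    CVectorField.deriv_bracket X Y f.contMDiff, sub_smul]
  rfl

/-- Traceless endomorphism fields are determined by their inner derivations. -/
theorem eq_of_commutator_eq (hF : 0 < Module.finrank ℂ F) {S T : EndAlg EM F V}
    (hS : ∀ x, LinearMap.trace ℂ (V x) (S.1 x).toLinearMap = 0)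
    (hT : ∀ x, LinearMap.trace ℂ (V x) (T.1 x).toLinearMap = 0)
    (h : ∀ U, S * U - U * S = T * U - U * T) : S = T := by
  refine EndAlg.ext fun x => sub_eq_zero.1 (eq_zero_of_commute_of_trace (EM := EM) hF _
    (fun U => ?_) ?_)
  · have h1 : S.1 x * U.1 x - U.1 x * S.1 x = T.1 x * U.1 x - U.1 x * T.1 x :=
      congrFun (congrArg Subtype.val (h U)) x
    rw [sub_mul, mul_sub, sub_eq_sub_iff_sub_eq_sub]
    exact h1
  · rw [ContinuousLinearMap.toLinearMap_sub, map_sub, hS, hT, sub_self]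

variable {nabla : CovariantDerivative 𝓘(ℝ, EM) F V}
  [CovariantDerivative.ContMDiffCovariantDerivative nabla ∞]

/-- `∇_X` and `D` have the same image, so their difference annihilates the scalars and is inner.
Quantifying over all `X` is harmless because the image is unique. -/
theorem exists_traceless_covEndo_sub (hlin : IsComplexLinear nabla)
    (hF : 0 < Module.finrank ℂ F) (D : Der ℂ (EndAlg EM F V)) : ∃ α : EndAlg EM F V,
      (∀ x, LinearMap.trace ℂ (V x) (α.1 x).toLinearMap = 0) ∧
        ∀ X, IsImage D X → ∀ S, α * S - S * α = covEndo hlin X S - D.1 S := by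
  obtain ⟨X, hX, hX'⟩ := existsUnique_isImage hF D
  obtain ⟨α, h1, h2⟩ := exists_traceless_inner hF (covDer hlin X - D) fun f => by
    change (covDer hlin X).1 (scalar f) - D.1 (scalar f) = 0
    rw [hX.apply_scalar, (isImage_covDer hlin X).apply_scalar, sub_self]
  refine ⟨α, h1, fun Y hY S => ?_⟩
  rw [hX' Y hY]
  exact (h2 S).symm

/-- The value of the associated `1`-form on a derivation. -/
def connForm (hlin : IsComplexLinear nabla) (hF : 0 < Module.finrank ℂ F)
    (D : Der ℂ (EndAlg EM F V)) : EndAlg EM F V :=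
  (exists_traceless_covEndo_sub hlin hF D).choose

theorem trace_connForm (hlin : IsComplexLinear nabla) (hF : 0 < Module.finrank ℂ F)
    (D : Der ℂ (EndAlg EM F V)) (x : M) :
    LinearMap.trace ℂ (V x) ((connForm hlin hF D).1 x).toLinearMap = 0 :=
  (exists_traceless_covEndo_sub hlin hF D).choose_spec.1 x

theorem connForm_commutator (hlin : IsComplexLinear nabla) (hF : 0 < Module.finrank ℂ F)
    {D : Der ℂ (EndAlg EM F V)} {X : CVectorField EM M} (hX : IsImage D X) (S : EndAlg EM F V) :
    connForm hlin hF D * S - S * connForm hlin hF D = covEndo hlin X S - D.1 S :=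
  (exists_traceless_covEndo_sub hlin hF D).choose_spec.2 X hX S

theorem exists_center_apply (hF : 0 < Module.finrank ℂ F) (z : Z ℂ (EndAlg EM F V)) (x : M) :
    ∃ c : ℂ, z.1.1 x = c • (1 : V x →L[ℂ] V x) :=
  ⟨_, eq_trace_smul_one hF z.1 fun T =>
    (congrFun (congrArg Subtype.val (Subalgebra.mem_center_iff.1 z.2 T)) x).symm⟩

/-- At `x` the central element `z` is a number `c`. Testing on functions gives `W = c X + Y` at `x`,
and a covariant derivative at `x` depends only on the value of the vector field there. -/
theorem covSec_of_isImage (hF : 0 < Module.finrank ℂ F) (z : Z ℂ (EndAlg EM F V))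
    {D D' : Der ℂ (EndAlg EM F V)} {X Y W : CVectorField EM M} (hX : IsImage D X)
    (hY : IsImage D' Y) (hW : IsImage (z • D + D') W) (s : Sec EM F V) :
    covSec nabla W s = actSec z.1 (covSec nabla X s) + covSec nabla Y s := by
  ext x
  obtain ⟨c, hc⟩ := exists_center_apply hF z x
  have h1 : ∀ f : C^∞⟮𝓘(ℝ, EM), M; 𝓘(ℝ, ℂ), ℂ⟯,
      W.deriv f x = c * X.deriv f x + Y.deriv f x := by
    intro f
    refine smul_one_injective F hF x ((hW f x).symm.trans ?_)
    change z.1.1 x * (D.1 (scalar f)).1 x + (D'.1 (scalar f)).1 x = _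
    rw [hc, hX, hY, smul_mul_smul_comm, one_mul, add_smul]
  -- The real and imaginary parts of `c X + Y` at `x`.
  obtain ⟨h2, h3⟩ := tangent_eq_zero (EM := EM) (x := x)
    (u := W.re x - (c.re • X.re x - c.im • X.im x + Y.re x))
    (w := W.im x - (c.re • X.im x + c.im • X.re x + Y.im x)) fun f => by
      have h4 := h1 f
      simp only [CVectorField.deriv] at h4
      simp only [map_sub, map_add, map_smul, Complex.real_smul]
      rw [← Complex.re_add_im c] at h4
      linear_combination h4 + c.im * mvfderiv 𝓘(ℝ, EM) f x (X.im x) * Complex.I_sq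
  change covSec nabla W s x = z.1.1 x (covSec nabla X s x) + covSec nabla Y s x
  have h5 : ∀ (r : ℝ) (v : V x), r • v = (r : ℂ) • v := fun r v => rfl
  rw [hc, covSec_apply, sub_eq_zero.1 h2, sub_eq_zero.1 h3]
  change _ = c • covSec nabla X s x + covSec nabla Y s x
  simp only [covSec_apply, map_sub, map_add, map_smul, h5]
  conv_rhs => rw [← Complex.re_add_im c]
  match_scalars <;> first | ring1 | linear_combination -(c.im : ℂ) * Complex.I_sq

/-- Both sides are traceless and have the same commutators, since `∇` along the image is itself
linear over the centre. -/
theorem connForm_smul_add (hlin : IsComplexLinear nabla) (hF : 0 < Module.finrank ℂ F)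
    (z : Z ℂ (EndAlg EM F V)) (D D' : Der ℂ (EndAlg EM F V)) :
    connForm hlin hF (z • D + D') = z.1 * connForm hlin hF D + connForm hlin hF D' := by
  obtain ⟨X, hX⟩ := exists_isImage hF D
  obtain ⟨Y, hY⟩ := exists_isImage hF D'
  obtain ⟨W, hW⟩ := exists_isImage hF (z • D + D')
  have hz : ∀ S : EndAlg EM F V, S * z.1 = z.1 * S := fun S => Subalgebra.mem_center_iff.1 z.2 S
  refine eq_of_commutator_eq hF (trace_connForm hlin hF _) (fun x => ?_) fun S => ?_
  · obtain ⟨c, hc⟩ := exists_center_apply hF z x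
    change LinearMap.trace ℂ (V x) (z.1.1 x * (connForm hlin hF D).1 x
      + (connForm hlin hF D').1 x).toLinearMap = 0
    rw [hc, smul_one_mul, ContinuousLinearMap.toLinearMap_add, ContinuousLinearMap.toLinearMap_smul,
      map_add, map_smul, trace_connForm, trace_connForm, smul_zero, add_zero]
  · have h1 : covEndo hlin W S = z.1 * covEndo hlin X S + covEndo hlin Y S :=
      eq_of_actSec fun s => by
        have h2 : actSec S (actSec z.1 (covSec nabla X s))
            = actSec z.1 (actSec S (covSec nabla X s)) := by
          rw [← actSec_mul, ← actSec_mul, hz]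
        simp only [add_actSec, actSec_mul, actSec_covEndo, covSec_of_isImage hF z hX hY hW,
          actSec_add, actSec_sub, h2]
        abel
    rw [connForm_commutator hlin hF hW, h1]
    have h3 : (z • D + D').1 S = z.1 * D.1 S + D'.1 S := rfl
    have h4 := connForm_commutator hlin hF hX S
    have h5 := connForm_commutator hlin hF hY S
    rw [commutator_mul_add (hz S), h3, h4, h5, mul_sub]
    abel

/-- The `1`-form associated to a connection. -/
def assocForm (hlin : IsComplexLinear nabla) (hF : 0 < Module.finrank ℂ F) :
    Form₁ ℂ (EndAlg EM F V) :=
  Form₁.ofSMulAdd (connForm hlin hF) (connForm_smul_add hlin hF)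

/-- Smooth sections reach every fibre vector, so the defining condition can be read in the algebra
and solved for the commutator with `a D`. -/
theorem isAssociated_iff (hlin : IsComplexLinear nabla) (a : Form₁ ℂ (EndAlg EM F V)) :
    IsAssociated nabla a ↔ (∀ D x, LinearMap.trace ℂ (V x) ((a D).1 x).toLinearMap = 0) ∧
      ∀ D X, IsImage D X → ∀ S, a D * S - S * a D = covEndo hlin X S - D.1 S := by
  refine and_congr_right fun _ => forall₃_congr fun D X _ => forall_congr' fun S => ?_
  constructor
  · intro h
    refine eq_of_actSec fun s => ContMDiffSection.ext fun x => ?_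
    have h1 := congrFun (h s) x
    rw [← act_covEndo hlin] at h1
    have h2 : (D.1 S).1 x (s x)
      = (covEndo hlin X S).1 x (s x) - (a D * S - S * a D).1 x (s x) := h1
    change (a D * S - S * a D).1 x (s x) = (covEndo hlin X S).1 x (s x) - (D.1 S).1 x (s x)
    rw [h2, sub_sub_cancel]
  · intro h s
    rw [← act_covEndo hlin, Ring.lie_def, h]
    funext x
    change (D.1 S).1 x (s x) = (covEndo hlin X S).1 x (s x)
      - ((covEndo hlin X S).1 x (s x) - (D.1 S).1 x (s x))
    rw [sub_sub_cancel]

theorem existsUnique_isAssociated (hlin : IsComplexLinear nabla) (hF : 0 < Module.finrank ℂ F) :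
    ∃! a : Form₁ ℂ (EndAlg EM F V), IsAssociated nabla a := by
  refine ⟨assocForm hlin hF, (isAssociated_iff hlin _).2 ⟨trace_connForm hlin hF,
    fun D X hX S => connForm_commutator hlin hF hX S⟩, fun a ha => Form₁.ext' fun D => ?_⟩
  obtain ⟨h1, h2⟩ := (isAssociated_iff hlin a).1 ha
  obtain ⟨X, hX⟩ := exists_isImage hF D
  exact eq_of_commutator_eq hF (h1 D) (trace_connForm hlin hF D) fun S =>
    (h2 D X hX S).trans (connForm_commutator hlin hF hX S).symm

/-- The curvature acts on sections as a commutator of operators; the mixed terms, in which one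
derivative falls on `S` and one on the section, cancel by symmetry. -/
theorem curvature_commutator (hlin : IsComplexLinear nabla) {X Y : CVectorField EM M}
    {R : EndAlg EM F V} (hR : ∀ s, curvSec nabla X Y s = actSec R s) (S : EndAlg EM F V) :
    R * S - S * R = covEndo hlin X (covEndo hlin Y S) - covEndo hlin Y (covEndo hlin X S)
      - covEndo hlin (X.bracket Y) S :=
  eq_of_actSec fun s => by
    simp only [sub_actSec, actSec_mul, ← hR, curvSec, actSec_covEndo, actSec_sub, covSec_sub]
    abel

/-- Derivations preserve tracelessness. -/
theorem trace_der (hlin : IsComplexLinear nabla) {a : Form₁ ℂ (EndAlg EM F V)}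
    (hF : 0 < Module.finrank ℂ F) (ha : IsAssociated nabla a) (D : Der ℂ (EndAlg EM F V))
    {T : EndAlg EM F V} (hT : ∀ x, LinearMap.trace ℂ (V x) (T.1 x).toLinearMap = 0) (x : M) :
    LinearMap.trace ℂ (V x) ((D.1 T).1 x).toLinearMap = 0 := by
  obtain ⟨X, hX⟩ := exists_isImage hF D
  have h1 : D.1 T = covEndo hlin X T - (a D * T - T * a D) := by
    rw [((isAssociated_iff hlin a).1 ha).2 D X hX T, sub_sub_cancel]
  have h2 : X.deriv (traceFun T) x = 0 := by
    rw [show ⇑(traceFun T) = fun _ => (0 : ℂ) from funext hT, X.deriv_const]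
  rw [h1]
  change LinearMap.trace ℂ (V x) ((covEndo hlin X T).1 x
    - ((a D).1 x * T.1 x - T.1 x * (a D).1 x)).toLinearMap = 0
  rw [ContinuousLinearMap.toLinearMap_sub, map_sub, trace_covEndo, h2, trace_mul_comm', sub_zero]

theorem covEndo_commutator (hlin : IsComplexLinear nabla) {a : Form₁ ℂ (EndAlg EM F V)}
    (ha : ∀ D X, IsImage D X → ∀ S, covEndo hlin X S = D.1 S + (a D * S - S * a D))
    {D D' : Der ℂ (EndAlg EM F V)} {X Y : CVectorField EM M} (hX : IsImage D X)
    (hY : IsImage D' Y) (S : EndAlg EM F V) :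
    covEndo hlin X (covEndo hlin Y S) - covEndo hlin Y (covEndo hlin X S)
      - covEndo hlin (X.bracket Y) S
      = (D.1 (a D') - D'.1 (a D) - a ⁅D, D'⁆ + (a D * a D' - a D' * a D)) * S
        - S * (D.1 (a D') - D'.1 (a D) - a ⁅D, D'⁆ + (a D * a D' - a D' * a D)) := by
  have h1 := ha D X hX
  have h2 := ha D' Y hY
  have h3 := ha ⁅D, D'⁆ (X.bracket Y) (hX.lie hY)
  exact commutator_curvature D D' h1 h2 h3 S

/-- The values of `a` are traceless, derivations preserve tracelessness, and commutators have trace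
zero. -/
theorem trace_d₁_add_lie (hlin : IsComplexLinear nabla) (hF : 0 < Module.finrank ℂ F)
    {a : Form₁ ℂ (EndAlg EM F V)} (ha : IsAssociated nabla a) (D D' : Der ℂ (EndAlg EM F V))
    (x : M) : LinearMap.trace ℂ (V x) ((D.1 (a D') - D'.1 (a D) - a ⁅D, D'⁆
      + (a D * a D' - a D' * a D)).1 x).toLinearMap = 0 := by
  have h1 := ha.1
  change LinearMap.trace ℂ (V x) ((D.1 (a D')).1 x - (D'.1 (a D)).1 x - (a ⁅D, D'⁆).1 x
    + ((a D).1 x * (a D').1 x - (a D').1 x * (a D).1 x)).toLinearMap = 0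
  rw [ContinuousLinearMap.toLinearMap_add, ContinuousLinearMap.toLinearMap_sub,
    ContinuousLinearMap.toLinearMap_sub, map_add, map_sub, map_sub, trace_mul_comm',
    trace_der hlin hF ha D (h1 D'), trace_der hlin hF ha D' (h1 D), h1]
  simp

/-- The curvature is the curvature of the associated `1`-form. -/
theorem eq_d₁_add_lie (hlin : IsComplexLinear nabla) {n : ℕ} (hn : 0 < n)
    (hrank : Module.finrank ℂ F = n) {su : SUStructure EM F V n} (hvol : PreservesVolume su nabla)
    {a : Form₁ ℂ (EndAlg EM F V)} (ha : IsAssociated nabla a) {D D' : Der ℂ (EndAlg EM F V)}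
    {X Y : CVectorField EM M} (hX : IsImage D X) (hY : IsImage D' Y)
    {R : EndAlg EM F V} (hR : ∀ s, curvSec nabla X Y s = actSec R s) :
    R = (d₁ a).1 D D' + ⁅a D, a D'⁆ := by
  have hF : 0 < Module.finrank ℂ F := by rwa [hrank]
  have h1 : ∀ D X, IsImage D X → ∀ S, covEndo hlin X S = D.1 S + (a D * S - S * a D) := by
    intro D X hX S
    rw [((isAssociated_iff hlin a).1 ha).2 D X hX S, add_sub_cancel]
  have h2 : R = D.1 (a D') - D'.1 (a D) - a ⁅D, D'⁆ + (a D * a D' - a D' * a D) :=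
    -- Equal commutators alone would give the identity up to a scalar field; preservation of the
    -- volume excludes it.
    eq_of_commutator_eq hF (trace_curvature hlin hrank hvol hR)
      (trace_d₁_add_lie hlin hF ha D D') fun S =>
        (curvature_commutator hlin hR S).trans (covEndo_commutator hlin h1 hX hY S)
  exact h2.trans (d₁_add_lie a D D').symm

theorem curvature_eq (hlin : IsComplexLinear nabla) {n : ℕ} (hn : 0 < n)
    (hrank : Module.finrank ℂ F = n) {su : SUStructure EM F V n} (hvol : PreservesVolume su nabla)
    {a : Form₁ ℂ (EndAlg EM F V)} (ha : IsAssociated nabla a) {D D' : Der ℂ (EndAlg EM F V)}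
    {X Y : CVectorField EM M} (hX : IsImage D X) (hY : IsImage D' Y) (s : Sec EM F V) :
    curvature nabla X Y s = act ((d₁ a).1 D D' + ⁅a D, a D'⁆) s := by
  have hR := (exists_curvature hlin X Y).choose_spec
  rw [← eq_d₁_add_lie hlin hn hrank hvol ha hX hY hR]
  exact (coe_curvSec X Y s).symm.trans (congrArg (fun t : Sec EM F V => ⇑t) (hR s))

/-- Scalar fields are central, so inner derivations annihilate them. -/
theorem IsImage.inner (γ : EndAlg EM F V) :
    IsImage (DerCalc.inner γ : Der ℂ (EndAlg EM F V)) ⟨0, 0⟩ := by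
  intro f x
  rw [inner_apply, ← scalar_mul_comm, sub_self]
  have h : CVectorField.deriv (EM := EM) (M := M) ⟨0, 0⟩ f x
    = mvfderiv 𝓘(ℝ, EM) f x 0 + Complex.I * mvfderiv 𝓘(ℝ, EM) f x 0 := rfl
  rw [h, map_zero, mul_zero, add_zero, zero_smul]
  rfl

theorem curvature_zero_left (Y : CVectorField EM M) (s : Sec EM F V) :
    curvSec nabla ⟨0, 0⟩ Y s = 0 := by
  have h1 : ∀ (f : M → ℂ) (x : M), CVectorField.deriv (EM := EM) ⟨0, 0⟩ f x = 0 := by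
    intro f x
    have h : CVectorField.deriv (EM := EM) (M := M) ⟨0, 0⟩ f x
      = mvfderiv 𝓘(ℝ, EM) f x 0 + Complex.I * mvfderiv 𝓘(ℝ, EM) f x 0 := rfl
    rw [h, map_zero, mul_zero, add_zero]
  -- The bracket is found from its action on functions.
  have h2 : CVectorField.bracket ⟨0, 0⟩ Y = ⟨0, 0⟩ := CVectorField.eq_of_deriv fun f x => by
    rw [CVectorField.deriv_bracket _ _ f.contMDiff, h1, h1,
      show CVectorField.deriv (EM := EM) ⟨0, 0⟩ f = fun _ => (0 : ℂ) from funext (h1 f),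
      CVectorField.deriv_const, sub_self]
  have h3 : ∀ t : Sec EM F V, covSec nabla ⟨0, 0⟩ t = 0 := by
    intro t
    ext x
    have h : covSec nabla ⟨0, 0⟩ t x = nabla t x 0 + Complex.I • nabla t x 0 := rfl
    rw [h, map_zero, smul_zero, add_zero]
    rfl
  have h4 : covSec nabla Y (0 : Sec EM F V) = 0 :=
    map_zero (AddMonoidHom.mk' (covSec nabla Y) (covSec_add nabla Y))
  rw [curvSec, h2, h3, h3, h4, sub_self, sub_self]

/-- The curvature identity for a derivation of image `0`, where the curvature field is `0`. -/
theorem d₁_inner_add_lie (hlin : IsComplexLinear nabla) {n : ℕ} (hn : 0 < n)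
    (hrank : Module.finrank ℂ F = n) {su : SUStructure EM F V n} (hvol : PreservesVolume su nabla)
    {a : Form₁ ℂ (EndAlg EM F V)} (ha : IsAssociated nabla a) (γ : EndAlg EM F V)
    (D : Der ℂ (EndAlg EM F V)) :
    (d₁ a).1 (DerCalc.inner γ) D + ⁅a (DerCalc.inner γ), a D⁆ = 0 := by
  have hF : 0 < Module.finrank ℂ F := by rwa [hrank]
  have hY := (exists_isImage hF D).choose_spec
  have h : ∀ s, curvSec nabla ⟨0, 0⟩ _ s = actSec (0 : EndAlg EM F V) s :=
    curvature_zero_left (exists_isImage hF D).choose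
  exact (eq_d₁_add_lie hlin hn hrank hvol ha (IsImage.inner γ) hY h).symm

/-- The curvature form of the associated `1`-form is horizontal. -/
theorem isHorizontal_of_isAssociated (hlin : IsComplexLinear nabla) {n : ℕ} (hn : 0 < n)
    (hrank : Module.finrank ℂ F = n) {su : SUStructure EM F V n} (hvol : PreservesVolume su nabla)
    {a : Form₁ ℂ (EndAlg EM F V)} (ha : IsAssociated nabla a) : IsHorizontal (d₁ a + sq₁ a) :=
  isHorizontal_d₁_add_sq₁ (d₁_inner_add_lie hlin hn hrank hvol ha)

end Associated

end SUBundle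
end

theorem mainTheorem3
    {EM : Type*} [NormedAddCommGroup EM] [NormedSpace ℝ EM] [FiniteDimensional ℝ EM]
    {M : Type*} [TopologicalSpace M] [ChartedSpace EM M] [IsManifold 𝓘(ℝ, EM) ∞ M]
    [T2Space M] [ParacompactSpace M]
    {F : Type*} [NormedAddCommGroup F] [NormedSpace ℂ F] [FiniteDimensional ℂ F]
    {V : M → Type*} [∀ x, AddCommGroup (V x)] [∀ x, Module ℂ (V x)]
    [TopologicalSpace (TotalSpace F V)] [∀ x, TopologicalSpace (V x)]
    [∀ x, IsTopologicalAddGroup (V x)] [∀ x, ContinuousSMul ℂ (V x)]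
    [FiberBundle F V] [VectorBundle ℂ F V] [VectorBundle ℝ F V]
    [ContMDiffVectorBundle ∞ F V 𝓘(ℝ, EM)]
    {n : ℕ} (hn : 0 < n) (hrank : Module.finrank ℂ F = n)
    (su : SUBundle.SUStructure EM F V n)
    (nabla : CovariantDerivative 𝓘(ℝ, EM) F V)
    [CovariantDerivative.ContMDiffCovariantDerivative nabla ∞]
    (hlin : SUBundle.IsComplexLinear nabla) (hvol : SUBundle.PreservesVolume su nabla) :
    -- every derivation has a well-defined image among the complex vector fields
    (∀ D : DerCalc.Der ℂ (SUBundle.EndAlg EM F V), ∃! X, SUBundle.IsImage D X) ∧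
    -- the associated noncommutative 1-form is well defined
    (∃! a : DerCalc.Form₁ ℂ (SUBundle.EndAlg EM F V), SUBundle.IsAssociated nabla a) ∧
    ∀ a : DerCalc.Form₁ ℂ (SUBundle.EndAlg EM F V), SUBundle.IsAssociated nabla a →
      (∀ D D' X Y, SUBundle.IsImage D X → SUBundle.IsImage D' Y → ∀ s : SUBundle.Sec EM F V,
        SUBundle.curvature nabla X Y s
          = SUBundle.act ((DerCalc.d₁ a).1 D D' + ⁅a D, a D'⁆) s) ∧
      DerCalc.IsHorizontal (DerCalc.d₁ a + DerCalc.sq₁ a) := by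
  have hF : 0 < Module.finrank ℂ F := by rwa [hrank]
  refine ⟨SUBundle.existsUnique_isImage hF, SUBundle.existsUnique_isAssociated hlin hF,
    fun a ha => ⟨fun D D' X Y hX hY s => SUBundle.curvature_eq hlin hn hrank hvol ha hX hY s,
      SUBundle.isHorizontal_of_isAssociated hlin hn hrank hvol ha⟩⟩
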